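/- **Non-Garbage Critical Pair Lemma (rooted graph transformation with relabelling).** *Graphs.* Fix a label alphabet $\mathcal L=(\mathcal L_V,\mathcal L_E)$ of finite sets. A *graph* is $G=(V,E,s,t,l,m,p)$ with $V,E$ finite sets, total functions $s,t:E\to V$ and $m:E\to\mathcal L_E$, and partial functions $l:V\rightharpoonup\mathcal L_V$ (node labels) and $p:V\rightharpoonup\mathbb Z_2$ (rootedness). It is a *TLRG* if $l$ and $p$ are total. A *morphism* is a pair of functions on nodes and edges preserving sources, targets, edge labels, and node labels and rootedness wherever these are defined; it is *undefinedness preserving* if $l_G=l_H\circ g_V$ and $p_G=p_H\circ g_V$. Isomorphisms are morphisms with an inverse morphism; $[G]$ is the isomorphism class of $G$, and $\mathcal G^{\oplus}(\mathcal L)$ is the collection of all $[G]$ with $G$ a TLRG. *Systems.* A *rule* $r=\langle L\leftarrow K\to R\rangle$ consists of TLRGs $L,R$, a graph $K$ and inclusions (injective morphisms) $K\to L$, $K\to R$. A *match* of $r$ in a TLRG $G$ is an injective morphism $g:L\to G$ such that no edge of $G\setminus g(L)$ is incident to a node of $g(L\setminus K)$. The rule is applied by (1) deleting $g(L\setminus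 K)$ from $G$ and making the label (rootedness) of $g(v)$ undefined for each node $v$ of $K$ whose label (rootedness) is undefined, and (2) disjointly adding $R\setminus K$ with its labels and rootedness, and giving $g(v)$ the label $l_R(v)$ (rootedness $p_R(v)$) for each node $v$ of $K$ whose label (rootedness) is undefined. We write $G\Rightarrow_{r,g}M$, a *direct derivation*, if $M$ is isomorphic to the result. Its *track* is the induced partial map from the nodes of $G$ to those of $M$, defined exactly on the nodes that are not deleted. A *GT system* $T=(\mathcal L,\mathcal R)$ has a finite set $\mathcal R$ of rules; $\Rightarrow_{\mathcal R}$ is direct derivation by some rule of $\mathcal R$, and a derivation $G\Rightarrow^*_{\mathcal R}M$ is an isomorphism $G\cong M$ or a finite sequence of direct derivations, whose track is the composition of the isomorphism or of the tracks of the steps. TLRGs $H_1,H_2$ are *joinable* if $H_1\Rightarrow^*_{\mathcal R}M\Leftarrow^*_{\mathcal R}H_2$ for some TLRG $M$. *Critical pairs.* A pair of direct derivations $H_1\Leftarrow_{r_1,g_1}G\Rightarrow_{r_2,g_2}H_2$ with $r_1,r_2\in\mathcal R$ is *parallelly independent* if $g_1(L_1)\cap g_2(L_2)\subseteq g_1(K_1)\cap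 g_2(K_2)$. Here images, intersections and inclusions are those of graphs with partial functions treated as sets, so that a node common to both matches must also have its label and its rootedness defined in both interfaces. The pair is *critical* if $G=g_1(L_1)\cup g_2(L_2)$, it is not parallelly independent, and $g_1\ne g_2$ in case $r_1=r_2$. Its *persistent* nodes are the nodes of $G$ deleted by neither step. It is *strongly joinable* if there are a TLRG $M$ and derivations $H_1\Rightarrow^*_{\mathcal R}M\Leftarrow^*_{\mathcal R}H_2$ such that for each persistent node $v$ the tracks of $G\Rightarrow H_1\Rightarrow^*M$ and of $G\Rightarrow H_2\Rightarrow^*M$ are both defined at $v$ and equal there. *Garbage.* Let $\mathbf D\subseteq\mathcal G^{\oplus}(\mathcal L)$. Its *subgraph closure* $\overline{\mathbf D}$ is the smallest set $\mathbf S\supseteq\mathbf D$ such that $[G]\in\mathbf S$ implies $[H]\in\mathbf S$ for all TLRGs $H\subseteq G$ (with undefinedness preserving inclusion). A critical pair $H_1\Leftarrow G\Rightarrow H_2$ is *non-garbage* with respect to $\mathbf D$ if $[G]\in\overline{\mathbf D}$. The system $T$ is *locally confluent on* $\mathbf D$ if $H_1,H_2$ are joinable whenever $H_1\Leftarrow_{\mathcal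 R}G\Rightarrow_{\mathcal R}H_2$ with $G,H_1,H_2$ TLRGs and $[G]\in\mathbf D$. **Theorem.** Let $T=(\mathcal L,\mathcal R)$ be a GT system as above and $\mathbf D\subseteq\mathcal G^{\oplus}(\mathcal L)$. If all critical pairs of $T$ that are non-garbage with respect to $\mathbf D$ are strongly joinable, then $T$ is locally confluent on $\mathbf D$. -/

import Mathlib

universe u v w

namespace RGT

/-- A label alphabet: finite sets of node labels and of edge labels. -/
structure LabelAlphabet where
  NodeLabel : Type u
  EdgeLabel : Type v
  finite_nodeLabel : Finite NodeLabel
  finite_edgeLabel : Finite EdgeLabel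

/-- A (partially labelled, partially rooted) finite directed graph over `𝓛`. Partial functions
are functions into `Option`; rootedness `1` means rooted, `0` unrooted. -/
structure PLRG (𝓛 : LabelAlphabet.{u, v}) where
  V : Type w
  E : Type w
  finite_V : Finite V
  finite_E : Finite E
  s : E → V
  t : E → V
  l : V → Option 𝓛.NodeLabel
  m : E → 𝓛.EdgeLabel
  p : V → Option (ZMod 2)

variable {𝓛 : LabelAlphabet.{u, v}}

/-- Totally labelled and totally rooted. -/
def PLRG.IsTLRG (G : PLRG.{u, v, w} 𝓛) : Prop :=
  (∀ x, (G.l x).isSome) ∧ (∀ x, (G.p x).isSome)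

/-- Graph morphisms: labels and rootedness are preserved where they are defined. -/
@[ext]
structure Hom (G H : PLRG.{u, v, w} 𝓛) where
  V : G.V → H.V
  E : G.E → H.E
  source : ∀ e, V (G.s e) = H.s (E e)
  target : ∀ e, V (G.t e) = H.t (E e)
  edgeLabel : ∀ e, G.m e = H.m (E e)
  nodeLabel : ∀ x a, G.l x = some a → H.l (V x) = some a
  rootedness : ∀ x b, G.p x = some b → H.p (V x) = some b

namespace Hom

def id (G : PLRG.{u, v, w} 𝓛) : Hom G G where
  V := fun x => x
  E := fun e => e
  source _ := rfl
  target _ := rfl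
  edgeLabel _ := rfl
  nodeLabel _ _ h := h
  rootedness _ _ h := h

def comp {G H M : PLRG.{u, v, w} 𝓛} (g : Hom H M) (f : Hom G H) : Hom G M where
  V := fun x => g.V (f.V x)
  E := fun e => g.E (f.E e)
  source e := by rw [f.source, g.source]
  target e := by rw [f.target, g.target]
  edgeLabel e := by rw [f.edgeLabel, g.edgeLabel]
  nodeLabel x a h := g.nodeLabel _ _ (f.nodeLabel _ _ h)
  rootedness x b h := g.rootedness _ _ (f.rootedness _ _ h)

def Injective {G H : PLRG.{u, v, w} 𝓛} (f : Hom G H) : Prop :=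
  Function.Injective f.V ∧ Function.Injective f.E

def UndefinednessPreserving {G H : PLRG.{u, v, w} 𝓛} (f : Hom G H) : Prop :=
  (∀ x, G.l x = H.l (f.V x)) ∧ (∀ x, G.p x = H.p (f.V x))

end Hom

/-- Isomorphisms: morphisms with an inverse morphism. -/
structure Iso (G H : PLRG.{u, v, w} 𝓛) where
  hom : Hom G H
  inv : Hom H G
  hom_inv : inv.comp hom = Hom.id G
  inv_hom : hom.comp inv = Hom.id H

namespace Iso

def refl (G : PLRG.{u, v, w} 𝓛) : Iso G G := ⟨Hom.id G, Hom.id G, rfl, rfl⟩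

def symm {G H : PLRG.{u, v, w} 𝓛} (f : Iso G H) : Iso H G :=
  ⟨f.inv, f.hom, f.inv_hom, f.hom_inv⟩

def trans {G H M : PLRG.{u, v, w} 𝓛} (f : Iso G H) (g : Iso H M) : Iso G M where
  hom := g.hom.comp f.hom
  inv := f.inv.comp g.inv
  hom_inv := by
    change f.inv.comp ((g.inv.comp g.hom).comp f.hom) = Hom.id G
    rw [g.hom_inv]; exact f.hom_inv
  inv_hom := by
    change g.hom.comp ((f.hom.comp f.inv).comp g.inv) = Hom.id M
    rw [f.inv_hom]; exact g.inv_hom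

end Iso

/-- Totally labelled, totally rooted graphs. -/
abbrev TLRG (𝓛 : LabelAlphabet.{u, v}) := {G : PLRG.{u, v, w} 𝓛 // G.IsTLRG}

/-- Isomorphism as an equivalence relation on totally labelled, totally rooted graphs. -/
instance isoSetoid (𝓛 : LabelAlphabet.{u, v}) : Setoid (TLRG.{u, v, w} 𝓛) where
  r G H := Nonempty (Iso G.1 H.1)
  iseqv :=
    { refl := fun G => ⟨Iso.refl G.1⟩
      symm := fun ⟨f⟩ => ⟨f.symm⟩
      trans := fun ⟨f⟩ ⟨g⟩ => ⟨f.trans g⟩ }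

/-- Abstract totally labelled, totally rooted graphs, i.e. isomorphism classes. -/
def AbstractTLRG (𝓛 : LabelAlphabet.{u, v}) := Quotient (isoSetoid.{u, v, w} 𝓛)

/-- The isomorphism class `[G]`. -/
def TLRG.cls (G : TLRG.{u, v, w} 𝓛) : AbstractTLRG.{u, v, w} 𝓛 :=
  Quotient.mk (isoSetoid 𝓛) G

/-! ### Parts of a graph, with labels and rootedness counted -/

/-- The items of which (the tuple describing) a graph is made up. Here `label x` and `root x`
stand for the pairs `(x, l x)` and `(x, p x)` in the graphs of the partial functions `l`, `p`. -/
inductive Item (G : PLRG.{u, v, w} 𝓛) where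
  | node (x : G.V)
  | edge (e : G.E)
  | label (x : G.V)
  | root (x : G.V)

/-- The image `f(G)` of a graph under a morphism `f : G → H`, as a part of `H`. The label of a node
`f x` belongs to `f(G)` iff it comes from a label of a node in `G`; same for rootedness. -/
def Hom.image {G H : PLRG.{u, v, w} 𝓛} (f : Hom G H) : Set (Item H) :=
  {i | (∃ x, i = Item.node (f.V x)) ∨ (∃ e, i = Item.edge (f.E e)) ∨
    (∃ x, (G.l x).isSome ∧ i = Item.label (f.V x)) ∨
    (∃ x, (G.p x).isSome ∧ i = Item.root (f.V x))}

/-- A graph as a part of itself. -/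
def PLRG.items (G : PLRG.{u, v, w} 𝓛) : Set (Item G) := (Hom.id G).image

/-! ### Subgraph closure -/

/-- `H` is, up to isomorphism, a subgraph of `G`, where the inclusion is required to be
undefinedness preserving. -/
def IsSubgraph (H G : PLRG.{u, v, w} 𝓛) : Prop :=
  ∃ i : Hom H G, i.Injective ∧ i.UndefinednessPreserving

def SubgraphClosed (D : Set (AbstractTLRG.{u, v, w} 𝓛)) : Prop :=
  ∀ G H : TLRG.{u, v, w} 𝓛, IsSubgraph H.1 G.1 → G.cls ∈ D → H.cls ∈ D

/-- The smallest subgraph closed set containing `D`. -/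
def subgraphClosure (D : Set (AbstractTLRG.{u, v, w} 𝓛)) : Set (AbstractTLRG.{u, v, w} 𝓛) :=
  ⋂₀ {S | D ⊆ S ∧ SubgraphClosed S}

/-! ### Rules and their application -/

/-- A rule `⟨L ← K → R⟩`; the inclusions of the interface are given as injective morphisms. -/
structure Rule (𝓛 : LabelAlphabet.{u, v}) where
  L : TLRG.{u, v, w} 𝓛
  K : PLRG.{u, v, w} 𝓛
  R : TLRG.{u, v, w} 𝓛
  inL : Hom K L.1
  inR : Hom K R.1
  inL_injective : inL.Injective
  inR_injective : inR.Injective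

/-- An injective morphism from the left-hand side that satisfies the dangling condition: no edge
outside `g(L)` is incident to a node in `g(L \ K)`. -/
structure Match (r : Rule.{u, v, w} 𝓛) (G : TLRG.{u, v, w} 𝓛) where
  g : Hom r.L.1 G.1
  injective : g.Injective
  dangling : ∀ e : G.1.E, e ∉ Set.range g.E → ∀ x : r.L.1.V, x ∉ Set.range r.inL.V →
    G.1.s e ≠ g.V x ∧ G.1.t e ≠ g.V x

namespace Match

variable {r : Rule.{u, v, w} 𝓛} {G : TLRG.{u, v, w} 𝓛} (μ : Match r G)

/-- The nodes in `g(L \ K)`. -/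
def deletedV : Set G.1.V := {y | ∃ x, x ∉ Set.range r.inL.V ∧ μ.g.V x = y}

/-- The edges in `g(L \ K)`. -/
def deletedE : Set G.1.E := {y | ∃ x, x ∉ Set.range r.inL.E ∧ μ.g.E x = y}

/-- The morphism `K → L → G`. -/
def interface : Hom r.K G.1 := μ.g.comp r.inL

theorem interface_not_deleted (k : r.K.V) : μ.interface.V k ∉ μ.deletedV := by
  rintro ⟨x, hx, h⟩
  exact hx ⟨k, (μ.injective.1 h).symm⟩

theorem source_not_deleted (e : G.1.E) (he : e ∉ μ.deletedE) : G.1.s e ∉ μ.deletedV := by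
  rintro ⟨x, hx, h⟩
  by_cases hr : e ∈ Set.range μ.g.E
  · obtain ⟨f, rfl⟩ := hr
    by_cases hf : f ∈ Set.range r.inL.E
    · obtain ⟨k, rfl⟩ := hf
      rw [← μ.g.source, ← r.inL.source] at h
      exact hx ⟨_, (μ.injective.1 h).symm⟩
    · exact he ⟨f, hf, rfl⟩
  · exact (μ.dangling e hr x hx).1 h.symm

theorem target_not_deleted (e : G.1.E) (he : e ∉ μ.deletedE) : G.1.t e ∉ μ.deletedV := by
  rintro ⟨x, hx, h⟩
  by_cases hr : e ∈ Set.range μ.g.E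
  · obtain ⟨f, rfl⟩ := hr
    by_cases hf : f ∈ Set.range r.inL.E
    · obtain ⟨k, rfl⟩ := hf
      rw [← μ.g.target, ← r.inL.target] at h
      exact hx ⟨_, (μ.injective.1 h).symm⟩
    · exact he ⟨f, hf, rfl⟩
  · exact (μ.dangling e hr x hx).2 h.symm

open Classical in
/-- The intermediate graph: `g(L \ K)` is deleted, and images of unlabelled nodes of `K` are made
unlabelled, images of nodes of `K` with undefined rootedness get undefined rootedness. -/
noncomputable def intermediate : PLRG.{u, v, w} 𝓛 where
  V := {y : G.1.V // y ∉ μ.deletedV}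
  E := {e : G.1.E // e ∉ μ.deletedE}
  finite_V := haveI := G.1.finite_V; inferInstance
  finite_E := haveI := G.1.finite_E; inferInstance
  s e := ⟨G.1.s e.1, μ.source_not_deleted e.1 e.2⟩
  t e := ⟨G.1.t e.1, μ.target_not_deleted e.1 e.2⟩
  l y := if ∃ k, r.K.l k = none ∧ μ.interface.V k = y.1 then none else G.1.l y.1
  m e := G.1.m e.1
  p y := if ∃ k, r.K.p k = none ∧ μ.interface.V k = y.1 then none else G.1.p y.1

open Classical in
/-- The node part of the comatch `R → H`, where the node set of the result graph `H` is the
disjoint union of that of the intermediate graph and that of `R \ K`. -/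
noncomputable def comatchV (x : r.R.1.V) :
    μ.intermediate.V ⊕ {x : r.R.1.V // x ∉ Set.range r.inR.V} :=
  if h : ∃ k, r.inR.V k = x then
    Sum.inl ⟨μ.interface.V h.choose, μ.interface_not_deleted h.choose⟩
  else Sum.inr ⟨x, h⟩

open Classical in
/-- The result graph: `R \ K` is added disjointly to the intermediate graph, keeping labels and
rootedness, and the image of each unlabelled node of `K` gets its label in `R`, the image of each
node of `K` with undefined rootedness gets its rootedness in `R`. -/
noncomputable def resultGraph : PLRG.{u, v, w} 𝓛 where
  V := μ.intermediate.V ⊕ {x : r.R.1.V // x ∉ Set.range r.inR.V}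
  E := μ.intermediate.E ⊕ {e : r.R.1.E // e ∉ Set.range r.inR.E}
  finite_V := haveI := μ.intermediate.finite_V; haveI := r.R.1.finite_V; inferInstance
  finite_E := haveI := μ.intermediate.finite_E; haveI := r.R.1.finite_E; inferInstance
  s := Sum.elim (fun e => Sum.inl (μ.intermediate.s e)) (fun e => μ.comatchV (r.R.1.s e.1))
  t := Sum.elim (fun e => Sum.inl (μ.intermediate.t e)) (fun e => μ.comatchV (r.R.1.t e.1))
  l := Sum.elim
    (fun y => if h : ∃ k, r.K.l k = none ∧ μ.interface.V k = y.1 then r.R.1.l (r.inR.V h.choose)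
      else μ.intermediate.l y)
    (fun x => r.R.1.l x.1)
  m := Sum.elim μ.intermediate.m (fun e => r.R.1.m e.1)
  p := Sum.elim
    (fun y => if h : ∃ k, r.K.p k = none ∧ μ.interface.V k = y.1 then r.R.1.p (r.inR.V h.choose)
      else μ.intermediate.p y)
    (fun x => r.R.1.p x.1)

open Classical in
theorem resultGraph_isTLRG : μ.resultGraph.IsTLRG := by
  constructor
  · rintro (y | x)
    · change Option.isSome (dite _ _ _) = true
      split_ifs with h
      · exact r.R.2.1 _
      · change Option.isSome (ite _ _ _) = true
        rw [if_neg h]; exact G.2.1 _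
    · exact r.R.2.1 _
  · rintro (y | x)
    · change Option.isSome (dite _ _ _) = true
      split_ifs with h
      · exact r.R.2.2 _
      · change Option.isSome (ite _ _ _) = true
        rw [if_neg h]; exact G.2.2 _
    · exact r.R.2.2 _

/-- The result graph, as a totally labelled, totally rooted graph. -/
noncomputable def result : TLRG.{u, v, w} 𝓛 := ⟨μ.resultGraph, μ.resultGraph_isTLRG⟩

end Match

/-- A direct derivation `G ⇒_{r,g} M`: a match, and an identification of `M` with the result graph
up to isomorphism. -/
structure DirectDerivation (r : Rule.{u, v, w} 𝓛) (G M : TLRG.{u, v, w} 𝓛) where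
  μ : Match r G
  iso : Iso μ.result.1 M.1

/-- The track morphism of a direct derivation (on nodes): a partial function, which is undefined
exactly on the deleted nodes. -/
def DirectDerivation.track {r : Rule.{u, v, w} 𝓛} {G M : TLRG.{u, v, w} 𝓛}
    (d : DirectDerivation r G M) : G.1.V →. M.1.V :=
  fun x => ⟨x ∉ d.μ.deletedV, fun h => d.iso.hom.V (Sum.inl ⟨x, h⟩)⟩

/-! ### Graph transformation systems, confluence -/

/-- A graph transformation system over `𝓛`: a finite set of rules. -/
structure GTSystem (𝓛 : LabelAlphabet.{u, v}) where
  rules : Set (Rule.{u, v, w} 𝓛)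
  finite_rules : rules.Finite

/-- Derivations `G ⇒* M`: isomorphisms, or finite sequences of direct derivations. -/
inductive Derivation (T : GTSystem.{u, v, w} 𝓛) : TLRG.{u, v, w} 𝓛 → TLRG.{u, v, w} 𝓛 →
    Type (max u v (w + 1)) where
  | iso {G M : TLRG.{u, v, w} 𝓛} (f : Iso G.1 M.1) : Derivation T G M
  | step {G H M : TLRG.{u, v, w} 𝓛} (r : Rule.{u, v, w} 𝓛) (hr : r ∈ T.rules)
      (d : DirectDerivation r G H) (ds : Derivation T H M) : Derivation T G M

/-- The track morphism of a derivation (on nodes): the composition of the tracks of its steps. -/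
def Derivation.track {T : GTSystem.{u, v, w} 𝓛} {G M : TLRG.{u, v, w} 𝓛} :
    Derivation T G M → (G.1.V →. M.1.V)
  | .iso f => fun x => Part.some (f.hom.V x)
  | .step _ _ d ds => ds.track.comp d.track

namespace GTSystem

variable (T : GTSystem.{u, v, w} 𝓛)

/-- `G` directly derives `H` by some rule of the system. -/
def DirectlyDerives (G H : TLRG.{u, v, w} 𝓛) : Prop :=
  ∃ r ∈ T.rules, Nonempty (DirectDerivation r G H)

def Joinable (H₁ H₂ : TLRG.{u, v, w} 𝓛) : Prop :=
  ∃ M : TLRG.{u, v, w} 𝓛, Nonempty (Derivation T H₁ M) ∧ Nonempty (Derivation T H₂ M)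

/-- Local confluence on `D` (local confluence up to garbage). -/
def LocallyConfluentOn (D : Set (AbstractTLRG.{u, v, w} 𝓛)) : Prop :=
  ∀ G H₁ H₂ : TLRG.{u, v, w} 𝓛, G.cls ∈ D → T.DirectlyDerives G H₁ → T.DirectlyDerives G H₂ →
    T.Joinable H₁ H₂

end GTSystem

/-! ### Critical pairs -/

/-- A pair of direct derivations `H₁ ⇐_{r₁,g₁} G ⇒_{r₂,g₂} H₂` by rules of the system. -/
structure DerivationPair (T : GTSystem.{u, v, w} 𝓛) where
  G : TLRG.{u, v, w} 𝓛
  H₁ : TLRG.{u, v, w} 𝓛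
  H₂ : TLRG.{u, v, w} 𝓛
  r₁ : Rule.{u, v, w} 𝓛
  r₂ : Rule.{u, v, w} 𝓛
  mem₁ : r₁ ∈ T.rules
  mem₂ : r₂ ∈ T.rules
  d₁ : DirectDerivation r₁ G H₁
  d₂ : DirectDerivation r₂ G H₂

namespace DerivationPair

variable {T : GTSystem.{u, v, w} 𝓛} (Φ : DerivationPair T)

/-- `g₁(L₁) ∩ g₂(L₂) ⊆ g₁(K₁) ∩ g₂(K₂)`. -/
def ParallelIndependent : Prop :=
  Φ.d₁.μ.g.image ∩ Φ.d₂.μ.g.image ⊆ Φ.d₁.μ.interface.image ∩ Φ.d₂.μ.interface.image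

/-- The last condition says that if `r₁ = r₂`, then `g₁ ≠ g₂`. -/
structure IsCritical : Prop where
  cover : Φ.G.1.items = Φ.d₁.μ.g.image ∪ Φ.d₂.μ.g.image
  not_independent : ¬ Φ.ParallelIndependent
  distinct : (⟨Φ.r₁, Φ.d₁.μ⟩ : Σ r, Match r Φ.G) ≠ ⟨Φ.r₂, Φ.d₂.μ⟩

/-- Non-garbage with respect to `D`. -/
def NonGarbage (D : Set (AbstractTLRG.{u, v, w} 𝓛)) : Prop := Φ.G.cls ∈ subgraphClosure D

/-- The persistent nodes: those deleted by neither of the two steps. -/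
def persist : Set Φ.G.1.V := {x | (Φ.d₁.track x).Dom ∧ (Φ.d₂.track x).Dom}

/-- Joinable, with all persistent nodes preserved and identified. -/
def StronglyJoinable : Prop :=
  ∃ (M : TLRG.{u, v, w} 𝓛) (δ₁ : Derivation T Φ.H₁ M) (δ₂ : Derivation T Φ.H₂ M),
    ∀ x ∈ Φ.persist,
      (δ₁.track.comp Φ.d₁.track) x = (δ₂.track.comp Φ.d₂.track) x ∧
      ((δ₁.track.comp Φ.d₁.track) x).Dom

end DerivationPair

end RGT

/-! Consider two steps from `G`. If rule and match coincide, both targets are isomorphic to the same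
result graph. If the steps are parallelly independent, each match survives the other step, and
applying the rules in either order gives the same graph (`Match.Preserves.exists_common_result`).

Otherwise let `S` be the union of the two match images (`exists_union`). It is a subgraph of `G`, so
its class lies in the subgraph closure. Both matches restrict to `S` (`Match.factor`), and the
restricted pair is critical, hence strongly joinable at some `M`. By the dangling condition, an edge
of `G` outside `S` meets `S` only in persistent nodes, so `G` is `S` with a context attached at
persistent nodes (`exists_context`). Strong joinability tracks these nodes through both derivations.
They are therefore never deleted, and the context can be carried along
(`Context.nonempty_derivation_attach`). Since the two tracks agree, both sides end with the context
attached to `M` in the same way.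

Results of rule applications are compared through `Presentation`: maps from the surviving part of
`G` and from `R` that cover the result and overlap exactly along `K`. Such data determine the result
up to an isomorphism compatible with the tracks (`Presentation.exists_iso`), because two graphs
covered by the same family with the same identifications are isomorphic (`exists_iso_of_cover`).
Commutation uses the analogous `DoublePresentation`; transport and extension amount to exhibiting a
presentation. -/

namespace RGT

variable {𝓛 : LabelAlphabet.{u, v}}

/-! ### Isomorphisms from common covers -/

/-- An isomorphism given by bijections on nodes and edges that respect the structure. -/
def Iso.ofEquiv {M N : PLRG.{u, v, w} 𝓛} (eV : M.V ≃ N.V) (eE : M.E ≃ N.E)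
    (hs : ∀ e, eV (M.s e) = N.s (eE e)) (ht : ∀ e, eV (M.t e) = N.t (eE e))
    (hl : ∀ x, M.l x = N.l (eV x)) (hm : ∀ e, M.m e = N.m (eE e))
    (hp : ∀ x, M.p x = N.p (eV x)) : Iso M N where
  hom :=
    { V := eV, E := eE, source := hs, target := ht, edgeLabel := hm
      nodeLabel := fun x a h => by rw [← hl, h]
      rootedness := fun x a h => by rw [← hp, h] }
  inv :=
    { V := eV.symm, E := eE.symm
      source := fun e => by rw [Equiv.symm_apply_eq, hs, Equiv.apply_symm_apply]
      target := fun e => by rw [Equiv.symm_apply_eq, ht, Equiv.apply_symm_apply]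
      edgeLabel := fun e => by rw [hm, Equiv.apply_symm_apply]
      nodeLabel := fun x a h => by rw [hl, Equiv.apply_symm_apply, h]
      rootedness := fun x a h => by rw [hp, Equiv.apply_symm_apply, h] }
  hom_inv := by ext x <;> simp [Hom.comp, Hom.id]
  inv_hom := by ext x <;> simp [Hom.comp, Hom.id]

namespace Iso

variable {G H : PLRG.{u, v, w} 𝓛} (f : Iso G H)

theorem inv_hom_V (x : G.V) : f.inv.V (f.hom.V x) = x :=
  congrFun (congrArg Hom.V f.hom_inv) x

theorem hom_inv_V (x : H.V) : f.hom.V (f.inv.V x) = x :=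
  congrFun (congrArg Hom.V f.inv_hom) x

theorem inv_hom_E (x : G.E) : f.inv.E (f.hom.E x) = x :=
  congrFun (congrArg Hom.E f.hom_inv) x

theorem hom_inv_E (x : H.E) : f.hom.E (f.inv.E x) = x :=
  congrFun (congrArg Hom.E f.inv_hom) x

/-- The bijection on nodes. -/
def equivV : G.V ≃ H.V := ⟨f.hom.V, f.inv.V, f.inv_hom_V, f.hom_inv_V⟩

/-- The bijection on edges. -/
def equivE : G.E ≃ H.E := ⟨f.hom.E, f.inv.E, f.inv_hom_E, f.hom_inv_E⟩

/-- A morphism alone could send an unlabelled node to a labelled one; the inverse morphism rules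
this out. -/
theorem l_hom (x : G.V) : H.l (f.hom.V x) = G.l x := by
  rcases h : G.l x with _ | a
  · rcases h' : H.l (f.hom.V x) with _ | b
    · rfl
    · have := f.inv.nodeLabel _ _ h'
      rw [inv_hom_V, h] at this
      exact this.symm
  · exact f.hom.nodeLabel _ _ h

theorem p_hom (x : G.V) : H.p (f.hom.V x) = G.p x := by
  rcases h : G.p x with _ | a
  · rcases h' : H.p (f.hom.V x) with _ | b
    · rfl
    · have := f.inv.rootedness _ _ h'
      rw [inv_hom_V, h] at this
      exact this.symm
  · exact f.hom.rootedness _ _ h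

end Iso

/-- Two surjections with the same kernel induce a bijection of their targets. -/
theorem exists_equiv_of_ker {I A B : Type*} {a : I → A} {b : I → B}
    (ha : Function.Surjective a) (hb : Function.Surjective b)
    (ker : ∀ i i', a i = a i' ↔ b i = b i') : ∃ e : A ≃ B, ∀ i, e (a i) = b i := by
  have key : ∀ i, b (Function.surjInv ha (a i)) = b i := fun i =>
    (ker _ _).1 (Function.surjInv_eq ha _)
  refine ⟨Equiv.ofBijective (fun x => b (Function.surjInv ha x)) ⟨fun x y h => ?_, fun y => ?_⟩, key⟩
  · have := (ker _ _).2 h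
    rwa [Function.surjInv_eq ha, Function.surjInv_eq ha] at this
  · obtain ⟨i, rfl⟩ := hb y
    exact ⟨a i, key i⟩

/-- Graphs covered in the same way by the same nodes and edges are isomorphic. -/
theorem exists_iso_of_cover {M N : PLRG.{u, v, w} 𝓛} {I J : Type*} {aV : I → M.V} {bV : I → N.V}
    {aE : J → M.E} {bE : J → N.E} (s t : J → I)
    (haV : Function.Surjective aV) (hbV : Function.Surjective bV)
    (haE : Function.Surjective aE) (hbE : Function.Surjective bE)
    (kerV : ∀ i i', aV i = aV i' ↔ bV i = bV i') (kerE : ∀ i i', aE i = aE i' ↔ bE i = bE i')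
    (hMs : ∀ j, M.s (aE j) = aV (s j)) (hMt : ∀ j, M.t (aE j) = aV (t j))
    (hNs : ∀ j, N.s (bE j) = bV (s j)) (hNt : ∀ j, N.t (bE j) = bV (t j))
    (hl : ∀ i, M.l (aV i) = N.l (bV i)) (hm : ∀ j, M.m (aE j) = N.m (bE j))
    (hp : ∀ i, M.p (aV i) = N.p (bV i)) : ∃ φ : Iso M N, ∀ i, φ.hom.V (aV i) = bV i := by
  obtain ⟨eV, heV⟩ := exists_equiv_of_ker haV hbV kerV
  obtain ⟨eE, heE⟩ := exists_equiv_of_ker haE hbE kerE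
  refine ⟨Iso.ofEquiv eV eE ?_ ?_ ?_ ?_ ?_, heV⟩
  · intro e; obtain ⟨j, rfl⟩ := haE e; rw [heE, hMs, hNs, heV]
  · intro e; obtain ⟨j, rfl⟩ := haE e; rw [heE, hMt, hNt, heV]
  · intro x; obtain ⟨i, rfl⟩ := haV x; rw [heV, hl]
  · intro e; obtain ⟨j, rfl⟩ := haE e; rw [heE, hm]
  · intro x; obtain ⟨i, rfl⟩ := haV x; rw [heV, hp]

/-! ### Removal of a part followed by gluing, for sets -/

/-- `M` is obtained from `X` by removing `D` and gluing in `R` along `X ← K → R`. -/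
structure IsGluing {X K R M : Type*} (D : Set X) (i : K → X) (r : K → R)
    (j : ∀ y, y ∉ D → M) (h : R → M) : Prop where
  surj : ∀ m, (∃ y hy, j y hy = m) ∨ ∃ x, h x = m
  j_inj : ∀ {y y' hy hy'}, j y hy = j y' hy' → y = y'
  h_inj : Function.Injective h
  eq_iff : ∀ {y hy x}, j y hy = h x ↔ ∃ k, i k = y ∧ r k = x

namespace IsGluing

variable {X K R M N : Type*} {D : Set X} {i : K → X} {r : K → R}
  {j : ∀ y, y ∉ D → M} {h : R → M} {j' : ∀ y, y ∉ D → N} {h' : R → N}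

theorem j_eq_iff (P : IsGluing D i r j h) {y y' hy hy'} : j y hy = j y' hy' ↔ y = y' :=
  ⟨P.j_inj, by rintro rfl; rfl⟩

theorem surjective (P : IsGluing D i r j h) :
    Function.Surjective (Sum.elim (fun y : {y // y ∉ D} => j y.1 y.2) h) := by
  intro m
  rcases P.surj m with ⟨y, hy, rfl⟩ | ⟨x, rfl⟩
  · exact ⟨Sum.inl ⟨y, hy⟩, rfl⟩
  · exact ⟨Sum.inr x, rfl⟩

/-- Which elements of the cover are identified depends only on `D`, `i` and `r`. This is what makes
gluings unique. -/
theorem ker (P : IsGluing D i r j h) (Q : IsGluing D i r j' h') (a b : {y // y ∉ D} ⊕ R) :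
    Sum.elim (fun y : {y // y ∉ D} => j y.1 y.2) h a =
        Sum.elim (fun y : {y // y ∉ D} => j y.1 y.2) h b ↔
      Sum.elim (fun y : {y // y ∉ D} => j' y.1 y.2) h' a =
        Sum.elim (fun y : {y // y ∉ D} => j' y.1 y.2) h' b := by
  rcases a with a | a <;> rcases b with b | b <;> simp only [Sum.elim_inl, Sum.elim_inr]
  · rw [P.j_eq_iff, Q.j_eq_iff]
  · rw [P.eq_iff, Q.eq_iff]
  · rw [eq_comm, P.eq_iff, eq_comm, Q.eq_iff]
  · rw [P.h_inj.eq_iff, Q.h_inj.eq_iff]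

theorem congr_target (P : IsGluing D i r j h) (e : M ≃ N) :
    IsGluing D i r (fun y hy => e (j y hy)) (fun x => e (h x)) where
  surj m := by
    rcases P.surj (e.symm m) with ⟨y, hy, hm⟩ | ⟨x, hm⟩
    · exact Or.inl ⟨y, hy, by rw [hm, e.apply_symm_apply]⟩
    · exact Or.inr ⟨x, by rw [hm, e.apply_symm_apply]⟩
  j_inj hj := P.j_inj (e.injective hj)
  h_inj := e.injective.comp P.h_inj
  eq_iff := by intro y hy x; rw [e.injective.eq_iff, P.eq_iff]

theorem congr_source {Y : Type*} (P : IsGluing D i r j h) (e : X ≃ Y) {D' : Set Y} {i' : K → Y}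
    (hi : ∀ k, i' k = e (i k)) (hD : ∀ y, y ∉ D' → e.symm y ∉ D)
    (hD' : ∀ x, x ∉ D → e x ∉ D') :
    IsGluing D' i' r (fun y hy => j (e.symm y) (hD y hy)) h where
  surj m := by
    rcases P.surj m with ⟨y, hy, rfl⟩ | ⟨x, rfl⟩
    · exact Or.inl ⟨e y, hD' y hy, by simp⟩
    · exact Or.inr ⟨x, rfl⟩
  j_inj hj := e.symm.injective (P.j_inj hj)
  h_inj := P.h_inj
  eq_iff := by
    intro y hy x
    rw [P.eq_iff]
    simp only [hi, Equiv.eq_symm_apply]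

/-- The extension of `j` by additional elements. -/
def sumMap {Z : Type*} (j : ∀ y, y ∉ D → M) {D' : Set (X ⊕ Z)}
    (hD : ∀ y, Sum.inl y ∉ D' → y ∉ D) : ∀ y, y ∉ D' → M ⊕ Z
  | Sum.inl y, hy => Sum.inl (j y (hD y hy))
  | Sum.inr z, _ => Sum.inr z

/-- Elements of `Z` are neither removed nor in the interface, so they pass through unchanged. This
is attachment of a context at the level of sets. -/
theorem sum {Z : Type*} (P : IsGluing D i r j h) {D' : Set (X ⊕ Z)} {i' : K → X ⊕ Z}
    (hi : ∀ k, i' k = Sum.inl (i k))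
    (hD : ∀ y, Sum.inl y ∉ D' → y ∉ D) (hD' : ∀ y, y ∉ D → Sum.inl y ∉ D')
    (hZ : ∀ z, Sum.inr z ∉ D') :
    IsGluing D' i' r (sumMap j hD) (fun x => Sum.inl (h x)) where
  surj m := by
    rcases m with m | z
    · rcases P.surj m with ⟨y, hy, rfl⟩ | ⟨x, rfl⟩
      · exact Or.inl ⟨Sum.inl y, hD' y hy, rfl⟩
      · exact Or.inr ⟨x, rfl⟩
    · exact Or.inl ⟨Sum.inr z, hZ z, rfl⟩
  j_inj := by
    rintro (y | z) (y' | z') hy hy' hj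
    · exact congrArg _ (P.j_inj (Sum.inl_injective hj))
    · cases hj
    · cases hj
    · exact congrArg _ (Sum.inr_injective hj)
  h_inj := Sum.inl_injective.comp P.h_inj
  eq_iff := by
    rintro (y | z) hy x
    · simp only [sumMap, Sum.inl.injEq, hi]
      exact P.eq_iff
    · simp [sumMap, hi]

end IsGluing

/-! ### Presentations of the result of a rule application -/

theorem Match.ext_g {r : Rule.{u, v, w} 𝓛} {G : TLRG.{u, v, w} 𝓛} {μ ν : Match r G}
    (h : μ.g = ν.g) : μ = ν := by
  cases μ; cases ν; cases h; rfl

namespace Match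

variable {r : Rule.{u, v, w} 𝓛} {G : TLRG.{u, v, w} 𝓛} (μ : Match r G)

theorem interface_not_deletedE (k : r.K.E) : μ.interface.E k ∉ μ.deletedE := by
  rintro ⟨x, hx, h⟩
  exact hx ⟨k, (μ.injective.2 h).symm⟩

theorem interface_injectiveV : Function.Injective μ.interface.V :=
  μ.injective.1.comp r.inL_injective.1

theorem interface_injectiveE : Function.Injective μ.interface.E :=
  μ.injective.2.comp r.inL_injective.2

end Match

/-- An elementwise description of `M` as the result of applying a rule at a match. -/
structure Presentation {r : Rule.{u, v, w} 𝓛} {G : TLRG.{u, v, w} 𝓛} (μ : Match r G)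
    (M : PLRG.{u, v, w} 𝓛) where
  jV : ∀ y, y ∉ μ.deletedV → M.V
  jE : ∀ e, e ∉ μ.deletedE → M.E
  hV : r.R.1.V → M.V
  hE : r.R.1.E → M.E
  glueV : IsGluing μ.deletedV μ.interface.V r.inR.V jV hV
  glueE : IsGluing μ.deletedE μ.interface.E r.inR.E jE hE
  sj : ∀ e he, M.s (jE e he) = jV (G.1.s e) (μ.source_not_deleted e he)
  tj : ∀ e he, M.t (jE e he) = jV (G.1.t e) (μ.target_not_deleted e he)
  sh : ∀ e, M.s (hE e) = hV (r.R.1.s e)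
  th : ∀ e, M.t (hE e) = hV (r.R.1.t e)
  mj : ∀ e he, M.m (jE e he) = G.1.m e
  mh : ∀ e, M.m (hE e) = r.R.1.m e
  -- Interface nodes with a defined label are included here although `lh` also fixes their label:
  -- residual matches need the label of `G` to survive at such nodes.
  lj : ∀ y hy, (∀ k, μ.interface.V k = y → r.K.l k ≠ none) → M.l (jV y hy) = G.1.l y
  lh : ∀ x, M.l (hV x) = r.R.1.l x
  pj : ∀ y hy, (∀ k, μ.interface.V k = y → r.K.p k ≠ none) → M.p (jV y hy) = G.1.p y
  ph : ∀ x, M.p (hV x) = r.R.1.p x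

namespace Presentation

variable {r : Rule.{u, v, w} 𝓛} {G : TLRG.{u, v, w} 𝓛} {μ : Match r G}
  {M N : PLRG.{u, v, w} 𝓛}

theorem j_interface (P : Presentation μ M) {k y} (hk : μ.interface.V k = y) (hy) :
    P.jV y hy = P.hV (r.inR.V k) := P.glueV.eq_iff.2 ⟨k, hk, rfl⟩

/-- Uniqueness of the result. Compatibility with `jV` means that the isomorphism respects the
tracks. -/
theorem exists_iso (P : Presentation μ M) (Q : Presentation μ N) :
    ∃ φ : Iso M N, ∀ y hy, φ.hom.V (P.jV y hy) = Q.jV y hy := by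
  obtain ⟨φ, hφ⟩ := exists_iso_of_cover
    (Sum.map (fun e : {e // e ∉ μ.deletedE} =>
      (⟨G.1.s e.1, μ.source_not_deleted e.1 e.2⟩ : {y // y ∉ μ.deletedV})) r.R.1.s)
    (Sum.map (fun e : {e // e ∉ μ.deletedE} =>
      (⟨G.1.t e.1, μ.target_not_deleted e.1 e.2⟩ : {y // y ∉ μ.deletedV})) r.R.1.t)
    P.glueV.surjective Q.glueV.surjective P.glueE.surjective Q.glueE.surjective
    (P.glueV.ker Q.glueV) (P.glueE.ker Q.glueE)
    (by rintro (e | e) <;> simp [P.sj, P.sh]) (by rintro (e | e) <;> simp [P.tj, P.th])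
    (by rintro (e | e) <;> simp [Q.sj, Q.sh]) (by rintro (e | e) <;> simp [Q.tj, Q.th])
    (by
      rintro (⟨y, hy⟩ | x)
      -- An interface node is also the image of a node of `R`, whose label is prescribed; any other
      -- node keeps its label from `G`.
      · by_cases hk : ∃ k, μ.interface.V k = y
        · obtain ⟨k, hk⟩ := hk
          simp [P.j_interface hk, Q.j_interface hk, P.lh, Q.lh]
        · simp only [Sum.elim_inl]
          rw [P.lj _ _ fun k h => (hk ⟨k, h⟩).elim, Q.lj _ _ fun k h => (hk ⟨k, h⟩).elim]
      · simp [P.lh, Q.lh])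
    (by rintro (e | e) <;> simp [P.mj, P.mh, Q.mj, Q.mh])
    (by
      rintro (⟨y, hy⟩ | x)
      · by_cases hk : ∃ k, μ.interface.V k = y
        · obtain ⟨k, hk⟩ := hk
          simp [P.j_interface hk, Q.j_interface hk, P.ph, Q.ph]
        · simp only [Sum.elim_inl]
          rw [P.pj _ _ fun k h => (hk ⟨k, h⟩).elim, Q.pj _ _ fun k h => (hk ⟨k, h⟩).elim]
      · simp [P.ph, Q.ph])
  exact ⟨φ, fun y hy => hφ (Sum.inl ⟨y, hy⟩)⟩

/-- Presentations transport along isomorphisms of the result. -/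
def congrTarget (P : Presentation μ M) (φ : Iso M N) : Presentation μ N where
  jV y hy := φ.hom.V (P.jV y hy)
  jE e he := φ.hom.E (P.jE e he)
  hV x := φ.hom.V (P.hV x)
  hE e := φ.hom.E (P.hE e)
  glueV := P.glueV.congr_target φ.equivV
  glueE := P.glueE.congr_target φ.equivE
  sj e he := by rw [← φ.hom.source, P.sj]
  tj e he := by rw [← φ.hom.target, P.tj]
  sh e := by rw [← φ.hom.source, P.sh]
  th e := by rw [← φ.hom.target, P.th]
  mj e he := by rw [← φ.hom.edgeLabel, P.mj]
  mh e := by rw [← φ.hom.edgeLabel, P.mh]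
  lj y hy h := by rw [φ.l_hom, P.lj y hy h]
  lh x := by rw [φ.l_hom, P.lh]
  pj y hy h := by rw [φ.p_hom, P.pj y hy h]
  ph x := by rw [φ.p_hom, P.ph]

end Presentation

namespace Match

variable {r : Rule.{u, v, w} 𝓛} {G : TLRG.{u, v, w} 𝓛} (μ : Match r G)

/-- Injectivity of `inR` makes the chosen preimage in `comatchV` equal to `k`. -/
theorem comatchV_inR (k : r.K.V) :
    μ.comatchV (r.inR.V k) = Sum.inl ⟨μ.interface.V k, μ.interface_not_deleted k⟩ := by
  have h : ∃ k', r.inR.V k' = r.inR.V k := ⟨k, rfl⟩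
  have hk := r.inR_injective.1 h.choose_spec
  rw [comatchV, dif_pos h]
  congr 2
  rw [hk]

theorem comatchV_of_notMem (x : r.R.1.V) (h : x ∉ Set.range r.inR.V) :
    μ.comatchV x = Sum.inr ⟨x, h⟩ := dif_neg h

open Classical in
/-- The edge part of the comatch. -/
noncomputable def comatchE (x : r.R.1.E) :
    μ.intermediate.E ⊕ {x : r.R.1.E // x ∉ Set.range r.inR.E} :=
  if h : ∃ k, r.inR.E k = x then
    Sum.inl ⟨μ.interface.E h.choose, μ.interface_not_deletedE h.choose⟩
  else Sum.inr ⟨x, h⟩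

theorem comatchE_inR (k : r.K.E) :
    μ.comatchE (r.inR.E k) = Sum.inl ⟨μ.interface.E k, μ.interface_not_deletedE k⟩ := by
  have h : ∃ k', r.inR.E k' = r.inR.E k := ⟨k, rfl⟩
  have hk := r.inR_injective.2 h.choose_spec
  rw [comatchE, dif_pos h]
  congr 2
  rw [hk]

theorem comatchE_of_notMem (x : r.R.1.E) (h : x ∉ Set.range r.inR.E) :
    μ.comatchE x = Sum.inr ⟨x, h⟩ := dif_neg h

theorem resultGraph_l_inl_of_forall (y : μ.intermediate.V)
    (h : ∀ k, μ.interface.V k = y.1 → r.K.l k ≠ none) :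
    μ.resultGraph.l (Sum.inl y) = G.1.l y.1 := by
  have h' : ¬ ∃ k, r.K.l k = none ∧ μ.interface.V k = y.1 := fun ⟨k, h1, h2⟩ => h k h2 h1
  refine (dif_neg h').trans (if_neg h')

theorem resultGraph_p_inl_of_forall (y : μ.intermediate.V)
    (h : ∀ k, μ.interface.V k = y.1 → r.K.p k ≠ none) :
    μ.resultGraph.p (Sum.inl y) = G.1.p y.1 := by
  have h' : ¬ ∃ k, r.K.p k = none ∧ μ.interface.V k = y.1 := fun ⟨k, h1, h2⟩ => h k h2 h1
  refine (dif_neg h').trans (if_neg h')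

/-- At an interface node whose label is undefined in `K`, the label is taken from `R` by
construction. If it is defined in `K`, then `G` and `R` both agree with `K`, so keeping the old
label gives the same value. -/
theorem resultGraph_l_comatchV (x : r.R.1.V) : μ.resultGraph.l (μ.comatchV x) = r.R.1.l x := by
  by_cases hx : x ∈ Set.range r.inR.V
  · obtain ⟨k, rfl⟩ := hx
    rw [comatchV_inR]
    rcases hk : r.K.l k with _ | a
    · have h : ∃ k', r.K.l k' = none ∧ μ.interface.V k' = μ.interface.V k := ⟨k, hk, rfl⟩
      refine (dif_pos h).trans ?_
      rw [μ.interface_injectiveV h.choose_spec.2]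
    · refine (μ.resultGraph_l_inl_of_forall ⟨_, μ.interface_not_deleted k⟩ fun k' h h' => ?_).trans ?_
      · rw [μ.interface_injectiveV h, hk] at h'
        cases h'
      · rw [r.inR.nodeLabel k a hk]
        exact μ.interface.nodeLabel k a hk
  · rw [comatchV_of_notMem μ x hx]
    rfl

theorem resultGraph_p_comatchV (x : r.R.1.V) : μ.resultGraph.p (μ.comatchV x) = r.R.1.p x := by
  by_cases hx : x ∈ Set.range r.inR.V
  · obtain ⟨k, rfl⟩ := hx
    rw [comatchV_inR]
    rcases hk : r.K.p k with _ | a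
    · have h : ∃ k', r.K.p k' = none ∧ μ.interface.V k' = μ.interface.V k := ⟨k, hk, rfl⟩
      refine (dif_pos h).trans ?_
      rw [μ.interface_injectiveV h.choose_spec.2]
    · refine (μ.resultGraph_p_inl_of_forall ⟨_, μ.interface_not_deleted k⟩ fun k' h h' => ?_).trans ?_
      · rw [μ.interface_injectiveV h, hk] at h'
        cases h'
      · rw [r.inR.rootedness k a hk]
        exact μ.interface.rootedness k a hk
  · rw [comatchV_of_notMem μ x hx]
    rfl

theorem isGluing_comatchV : IsGluing μ.deletedV μ.interface.V r.inR.V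
    (fun y hy => (Sum.inl ⟨y, hy⟩ : μ.resultGraph.V)) μ.comatchV where
  surj := by
    rintro (⟨y, hy⟩ | ⟨x, hx⟩)
    · exact Or.inl ⟨y, hy, rfl⟩
    · exact Or.inr ⟨x, comatchV_of_notMem μ x hx⟩
  j_inj h := congrArg Subtype.val (Sum.inl_injective h)
  h_inj x x' h := by
    by_cases hx : x ∈ Set.range r.inR.V <;> by_cases hx' : x' ∈ Set.range r.inR.V
    · obtain ⟨k, rfl⟩ := hx
      obtain ⟨k', rfl⟩ := hx'
      rw [comatchV_inR, comatchV_inR] at h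
      rw [μ.interface_injectiveV (congrArg Subtype.val (Sum.inl_injective h))]
    · obtain ⟨k, rfl⟩ := hx
      rw [comatchV_inR, comatchV_of_notMem μ x' hx'] at h
      cases h
    · obtain ⟨k, rfl⟩ := hx'
      rw [comatchV_inR, comatchV_of_notMem μ x hx] at h
      cases h
    · rw [comatchV_of_notMem μ x hx, comatchV_of_notMem μ x' hx'] at h
      exact congrArg Subtype.val (Sum.inr_injective h)
  eq_iff := by
    intro y hy x
    constructor
    · intro h
      by_cases hx : x ∈ Set.range r.inR.V
      · obtain ⟨k, rfl⟩ := hx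
        rw [comatchV_inR] at h
        exact ⟨k, (congrArg Subtype.val (Sum.inl_injective h)).symm, rfl⟩
      · rw [comatchV_of_notMem μ x hx] at h
        cases h
    · rintro ⟨k, rfl, rfl⟩
      rw [comatchV_inR]

theorem isGluing_comatchE : IsGluing μ.deletedE μ.interface.E r.inR.E
    (fun y hy => (Sum.inl ⟨y, hy⟩ : μ.resultGraph.E)) μ.comatchE where
  surj := by
    rintro (⟨y, hy⟩ | ⟨x, hx⟩)
    · exact Or.inl ⟨y, hy, rfl⟩
    · exact Or.inr ⟨x, comatchE_of_notMem μ x hx⟩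
  j_inj h := congrArg Subtype.val (Sum.inl_injective h)
  h_inj x x' h := by
    by_cases hx : x ∈ Set.range r.inR.E <;> by_cases hx' : x' ∈ Set.range r.inR.E
    · obtain ⟨k, rfl⟩ := hx
      obtain ⟨k', rfl⟩ := hx'
      rw [comatchE_inR, comatchE_inR] at h
      rw [μ.interface_injectiveE (congrArg Subtype.val (Sum.inl_injective h))]
    · obtain ⟨k, rfl⟩ := hx
      rw [comatchE_inR, comatchE_of_notMem μ x' hx'] at h
      cases h
    · obtain ⟨k, rfl⟩ := hx'
      rw [comatchE_inR, comatchE_of_notMem μ x hx] at h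
      cases h
    · rw [comatchE_of_notMem μ x hx, comatchE_of_notMem μ x' hx'] at h
      exact congrArg Subtype.val (Sum.inr_injective h)
  eq_iff := by
    intro y hy x
    constructor
    · intro h
      by_cases hx : x ∈ Set.range r.inR.E
      · obtain ⟨k, rfl⟩ := hx
        rw [comatchE_inR] at h
        exact ⟨k, (congrArg Subtype.val (Sum.inl_injective h)).symm, rfl⟩
      · rw [comatchE_of_notMem μ x hx] at h
        cases h
    · rintro ⟨k, rfl, rfl⟩
      rw [comatchE_inR]

/-- The result graph is a result. -/
noncomputable def presentation : Presentation μ μ.resultGraph where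
  jV y hy := Sum.inl ⟨y, hy⟩
  jE y hy := Sum.inl ⟨y, hy⟩
  hV := μ.comatchV
  hE := μ.comatchE
  glueV := μ.isGluing_comatchV
  glueE := μ.isGluing_comatchE
  sj _ _ := rfl
  tj _ _ := rfl
  sh e := by
    by_cases hx : e ∈ Set.range r.inR.E
    · obtain ⟨k, rfl⟩ := hx
      rw [comatchE_inR, ← r.inR.source, comatchV_inR]
      exact congrArg Sum.inl (Subtype.ext (μ.interface.source k).symm)
    · rw [comatchE_of_notMem μ e hx]; rfl
  th e := by
    by_cases hx : e ∈ Set.range r.inR.E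
    · obtain ⟨k, rfl⟩ := hx
      rw [comatchE_inR, ← r.inR.target, comatchV_inR]
      exact congrArg Sum.inl (Subtype.ext (μ.interface.target k).symm)
    · rw [comatchE_of_notMem μ e hx]; rfl
  mj _ _ := rfl
  mh e := by
    by_cases hx : e ∈ Set.range r.inR.E
    · obtain ⟨k, rfl⟩ := hx
      rw [comatchE_inR, ← r.inR.edgeLabel]
      exact (μ.interface.edgeLabel k).symm
    · rw [comatchE_of_notMem μ e hx]; rfl
  lj y hy h := μ.resultGraph_l_inl_of_forall ⟨y, hy⟩ h
  lh := μ.resultGraph_l_comatchV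
  pj y hy h := μ.resultGraph_p_inl_of_forall ⟨y, hy⟩ h
  ph := μ.resultGraph_p_comatchV

end Match

/-- The result of a direct derivation is a result; surviving nodes are tracked. -/
noncomputable def DirectDerivation.presentation {r : Rule.{u, v, w} 𝓛} {G M : TLRG.{u, v, w} 𝓛}
    (d : DirectDerivation r G M) : Presentation d.μ M.1 :=
  d.μ.presentation.congrTarget d.iso

/-- By uniqueness of results, a presentation suffices to establish a step. -/
theorem Presentation.nonempty_directDerivation {r : Rule.{u, v, w} 𝓛} {G M : TLRG.{u, v, w} 𝓛}
    {μ : Match r G} (P : Presentation μ M.1) : Nonempty (DirectDerivation r G M) :=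
  let ⟨φ, _⟩ := μ.presentation.exists_iso P
  ⟨⟨μ, φ⟩⟩

/-! ### Two independent gluings, for sets -/

/-- `M` is obtained from `X` by removing `D₁ ∪ D₂` and gluing in `R₁` along `X ← K₁ → R₁` and `R₂`
along `X ← K₂ → R₂`. -/
structure IsDoubleGluing {X K₁ K₂ R₁ R₂ M : Type*} (D₁ D₂ : Set X) (i₁ : K₁ → X) (r₁ : K₁ → R₁)
    (i₂ : K₂ → X) (r₂ : K₂ → R₂) (j : ∀ y, y ∉ D₁ → y ∉ D₂ → M) (h₁ : R₁ → M) (h₂ : R₂ → M) :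
    Prop where
  surj : ∀ m, (∃ y hy hy', j y hy hy' = m) ∨ (∃ x, h₁ x = m) ∨ ∃ x, h₂ x = m
  j_inj : ∀ {y y' a b a' b'}, j y a b = j y' a' b' → y = y'
  inj₁ : Function.Injective h₁
  inj₂ : Function.Injective h₂
  eq_iff₁ : ∀ {y a b x}, j y a b = h₁ x ↔ ∃ k, i₁ k = y ∧ r₁ k = x
  eq_iff₂ : ∀ {y a b x}, j y a b = h₂ x ↔ ∃ k, i₂ k = y ∧ r₂ k = x
  eq_iff₁₂ : ∀ {x₁ x₂}, h₁ x₁ = h₂ x₂ ↔ ∃ k₁ k₂, i₁ k₁ = i₂ k₂ ∧ r₁ k₁ = x₁ ∧ r₂ k₂ = x₂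

namespace IsDoubleGluing

variable {X K₁ K₂ R₁ R₂ M N : Type*} {D₁ D₂ : Set X} {i₁ : K₁ → X} {r₁ : K₁ → R₁}
    {i₂ : K₂ → X} {r₂ : K₂ → R₂} {j : ∀ y, y ∉ D₁ → y ∉ D₂ → M} {h₁ : R₁ → M} {h₂ : R₂ → M}
    {j' : ∀ y, y ∉ D₁ → y ∉ D₂ → N} {h₁' : R₁ → N} {h₂' : R₂ → N}

theorem swap (P : IsDoubleGluing D₁ D₂ i₁ r₁ i₂ r₂ j h₁ h₂) :
    IsDoubleGluing D₂ D₁ i₂ r₂ i₁ r₁ (fun y a b => j y b a) h₂ h₁ where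
  surj m := by
    rcases P.surj m with ⟨y, a, b, h⟩ | h | h
    exacts [Or.inl ⟨y, b, a, h⟩, Or.inr (Or.inr h), Or.inr (Or.inl h)]
  j_inj h := P.j_inj h
  inj₁ := P.inj₂
  inj₂ := P.inj₁
  eq_iff₁ := P.eq_iff₂
  eq_iff₂ := P.eq_iff₁
  eq_iff₁₂ := by
    intro x₁ x₂
    rw [eq_comm, P.eq_iff₁₂]
    exact ⟨fun ⟨a, b, h, h', h''⟩ => ⟨b, a, h.symm, h'', h'⟩,
      fun ⟨a, b, h, h', h''⟩ => ⟨b, a, h.symm, h'', h'⟩⟩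

theorem j_eq_iff (P : IsDoubleGluing D₁ D₂ i₁ r₁ i₂ r₂ j h₁ h₂) {y y' a b a' b'} :
    j y a b = j y' a' b' ↔ y = y' :=
  ⟨P.j_inj, by rintro rfl; rfl⟩

/-- The cover of a double gluing by its three parts. -/
def cover (j : ∀ y, y ∉ D₁ → y ∉ D₂ → M) (h₁ : R₁ → M) (h₂ : R₂ → M) :
    {y // y ∉ D₁ ∧ y ∉ D₂} ⊕ R₁ ⊕ R₂ → M
  | Sum.inl y => j y.1 y.2.1 y.2.2
  | Sum.inr (Sum.inl x) => h₁ x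
  | Sum.inr (Sum.inr x) => h₂ x

theorem surjective (P : IsDoubleGluing D₁ D₂ i₁ r₁ i₂ r₂ j h₁ h₂) :
    Function.Surjective (cover j h₁ h₂) := by
  intro m
  rcases P.surj m with ⟨y, a, b, rfl⟩ | ⟨x, rfl⟩ | ⟨x, rfl⟩
  · exact ⟨Sum.inl ⟨y, a, b⟩, rfl⟩
  · exact ⟨Sum.inr (Sum.inl x), rfl⟩
  · exact ⟨Sum.inr (Sum.inr x), rfl⟩

theorem ker (P : IsDoubleGluing D₁ D₂ i₁ r₁ i₂ r₂ j h₁ h₂)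
    (Q : IsDoubleGluing D₁ D₂ i₁ r₁ i₂ r₂ j' h₁' h₂') (a b : {y // y ∉ D₁ ∧ y ∉ D₂} ⊕ R₁ ⊕ R₂) :
    cover j h₁ h₂ a = cover j h₁ h₂ b ↔ cover j' h₁' h₂' a = cover j' h₁' h₂' b := by
  rcases a with a | a | a <;> rcases b with b | b | b <;> simp only [cover]
  · rw [P.j_eq_iff, Q.j_eq_iff]
  · rw [P.eq_iff₁, Q.eq_iff₁]
  · rw [P.eq_iff₂, Q.eq_iff₂]
  · rw [eq_comm, P.eq_iff₁, eq_comm, Q.eq_iff₁]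
  · rw [P.inj₁.eq_iff, Q.inj₁.eq_iff]
  · rw [P.eq_iff₁₂, Q.eq_iff₁₂]
  · rw [eq_comm, P.eq_iff₂, eq_comm, Q.eq_iff₂]
  · rw [eq_comm, P.eq_iff₁₂, eq_comm, Q.eq_iff₁₂]
  · rw [P.inj₂.eq_iff, Q.inj₂.eq_iff]

end IsDoubleGluing

/-- The second gluing removes from `H` only what `D₂` removes from `X`, and its interface already
lives in `X`. An element shared by `R₁` and `R₂` therefore comes from a point of `H` in both `R₁`
and the image of `K₂`, that is, from a point of `X` in both interfaces. -/
theorem IsGluing.double {X K₁ K₂ R₁ R₂ H M : Type*} {D₁ D₂ : Set X} {i₁ : K₁ → X} {r₁ : K₁ → R₁}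
    {i₂ : K₂ → X} {r₂ : K₂ → R₂} {j₁ : ∀ y, y ∉ D₁ → H} {h₁ : R₁ → H}
    {D' : Set H} {i' : K₂ → H} {j' : ∀ y, y ∉ D' → M} {h' : R₂ → M}
    (P : IsGluing D₁ i₁ r₁ j₁ h₁) (Q : IsGluing D' i' r₂ j' h')
    (hD : ∀ y hy, j₁ y hy ∉ D' ↔ y ∉ D₂) (hD' : ∀ x, h₁ x ∉ D') (hi₂ : ∀ k, i₂ k ∉ D₁)
    (hi : ∀ k, i' k = j₁ (i₂ k) (hi₂ k)) :
    IsDoubleGluing D₁ D₂ i₁ r₁ i₂ r₂ (fun y a b => j' (j₁ y a) ((hD y a).2 b))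
      (fun x => j' (h₁ x) (hD' x)) h' where
  surj m := by
    rcases Q.surj m with ⟨y, hy, rfl⟩ | h
    · rcases P.surj y with ⟨z, hz, rfl⟩ | ⟨x, rfl⟩
      · exact Or.inl ⟨z, hz, (hD z hz).1 hy, rfl⟩
      · exact Or.inr (Or.inl ⟨x, rfl⟩)
    · exact Or.inr (Or.inr h)
  j_inj h := P.j_inj (Q.j_inj h)
  inj₁ x x' h := P.h_inj (Q.j_inj h)
  inj₂ := Q.h_inj
  eq_iff₁ := by intro y a b x; rw [Q.j_eq_iff, P.eq_iff]
  eq_iff₂ := by intro y a b x; simp only [Q.eq_iff, hi, P.j_eq_iff]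
  eq_iff₁₂ := by
    intro x₁ x₂
    rw [Q.eq_iff]
    constructor
    · rintro ⟨k, hk, hk'⟩
      rw [hi, P.eq_iff] at hk
      obtain ⟨k₁, h, h'⟩ := hk
      exact ⟨k₁, k, h, h', hk'⟩
    · rintro ⟨k₁, k, h, h', hk'⟩
      exact ⟨k, by rw [hi, P.eq_iff]; exact ⟨k₁, h, h'⟩, hk'⟩

/-! ### Parallel independence and commutation -/

/-- The step at `μ₁` neither deletes nor relabels anything in the image of `μ₂`. -/
structure Match.Preserves {r₁ r₂ : Rule.{u, v, w} 𝓛} {G : TLRG.{u, v, w} 𝓛} (μ₁ : Match r₁ G)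
    (μ₂ : Match r₂ G) : Prop where
  node : ∀ x₁ x₂, μ₁.g.V x₁ = μ₂.g.V x₂ → x₁ ∈ Set.range r₁.inL.V
  edge : ∀ x₁ x₂, μ₁.g.E x₁ = μ₂.g.E x₂ → x₁ ∈ Set.range r₁.inL.E
  label : ∀ k x, μ₁.interface.V k = μ₂.g.V x → r₁.K.l k ≠ none
  root : ∀ k x, μ₁.interface.V k = μ₂.g.V x → r₁.K.p k ≠ none

namespace Match.Preserves

variable {r₁ r₂ : Rule.{u, v, w} 𝓛} {G : TLRG.{u, v, w} 𝓛} {μ₁ : Match r₁ G} {μ₂ : Match r₂ G}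

/-- Left-hand sides are totally labelled and rooted, so a node common to both images contributes its
label and root items too. Their presence in the interface image forces the label and rootedness to
be defined in `K`, at a node that injectivity determines. -/
theorem of_subset (h : μ₁.g.image ∩ μ₂.g.image ⊆ μ₁.interface.image) : μ₁.Preserves μ₂ where
  node x₁ x₂ e := by
    have := @h (Item.node (μ₁.g.V x₁)) ⟨Or.inl ⟨x₁, rfl⟩, Or.inl ⟨x₂, by rw [e]⟩⟩
    simp only [Hom.image, Set.mem_ofPred_eq, Item.node.injEq, reduceCtorEq, exists_false, and_false,
      or_false] at this
    obtain ⟨k, hk⟩ := this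
    exact ⟨k, μ₁.injective.1 hk.symm⟩
  edge x₁ x₂ e := by
    have := @h (Item.edge (μ₁.g.E x₁)) ⟨Or.inr (Or.inl ⟨x₁, rfl⟩), Or.inr (Or.inl ⟨x₂, by rw [e]⟩)⟩
    simp only [Hom.image, Set.mem_ofPred_eq, Item.edge.injEq, reduceCtorEq, exists_false, and_false,
      or_false, false_or] at this
    obtain ⟨k, hk⟩ := this
    exact ⟨k, μ₁.injective.2 hk.symm⟩
  label k x e hk := by
    have := @h (Item.label (μ₁.interface.V k))
      ⟨Or.inr (Or.inr (Or.inl ⟨r₁.inL.V k, r₁.L.2.1 _, rfl⟩)),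
        Or.inr (Or.inr (Or.inl ⟨x, r₂.L.2.1 _, by rw [e]⟩))⟩
    simp only [Hom.image, Set.mem_ofPred_eq, Item.label.injEq, reduceCtorEq, exists_false, and_false,
      or_false, false_or] at this
    obtain ⟨k', h', hk'⟩ := this
    rw [← μ₁.interface_injectiveV hk', hk] at h'
    cases h'
  root k x e hk := by
    have := @h (Item.root (μ₁.interface.V k))
      ⟨Or.inr (Or.inr (Or.inr ⟨r₁.inL.V k, r₁.L.2.2 _, rfl⟩)),
        Or.inr (Or.inr (Or.inr ⟨x, r₂.L.2.2 _, by rw [e]⟩))⟩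
    simp only [Hom.image, Set.mem_ofPred_eq, Item.root.injEq, reduceCtorEq, exists_false, and_false,
      false_or] at this
    obtain ⟨k', h', hk'⟩ := this
    rw [← μ₁.interface_injectiveV hk', hk] at h'
    cases h'

theorem node_notMem (h : μ₁.Preserves μ₂) (x : r₂.L.1.V) : μ₂.g.V x ∉ μ₁.deletedV := by
  rintro ⟨y, hy, e⟩
  exact hy (h.node _ _ e)

theorem edge_notMem (h : μ₁.Preserves μ₂) (x : r₂.L.1.E) : μ₂.g.E x ∉ μ₁.deletedE := by
  rintro ⟨y, hy, e⟩
  exact hy (h.edge _ _ e)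

end Match.Preserves

section Commutation

variable {r₁ r₂ : Rule.{u, v, w} 𝓛} {G H : TLRG.{u, v, w} 𝓛} {μ₁ : Match r₁ G} {μ₂ : Match r₂ G}

theorem Presentation.jV_congr {M : PLRG.{u, v, w} 𝓛} (P : Presentation μ₁ M) {y y'} (h : y = y')
    (hy hy') : P.jV y hy = P.jV y' hy' := by subst h; rfl

/-- The residual of a match after an independent step. -/
def Presentation.residual (P : Presentation μ₁ H.1) (h₁₂ : μ₁.Preserves μ₂)
    (h₂₁ : μ₂.Preserves μ₁) : Match r₂ H where
  g :=
    { V := fun x => P.jV (μ₂.g.V x) (h₁₂.node_notMem x)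
      E := fun e => P.jE (μ₂.g.E e) (h₁₂.edge_notMem e)
      source := fun e => by rw [P.sj]; exact P.jV_congr (μ₂.g.source e) _ _
      target := fun e => by rw [P.tj]; exact P.jV_congr (μ₂.g.target e) _ _
      edgeLabel := fun e => by rw [P.mj, ← μ₂.g.edgeLabel]
      nodeLabel := fun x a h => by
        rw [P.lj _ _ fun k hk => h₁₂.label k x hk, μ₂.g.nodeLabel x a h]
      rootedness := fun x a h => by
        rw [P.pj _ _ fun k hk => h₁₂.root k x hk, μ₂.g.rootedness x a h] }
  injective := ⟨fun _ _ h => μ₂.injective.1 (P.glueV.j_inj h),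
    fun _ _ h => μ₂.injective.2 (P.glueE.j_inj h)⟩
  dangling e he x hx := by
    rcases P.glueE.surj e with ⟨e, he', rfl⟩ | ⟨f, rfl⟩
    · have := μ₂.dangling e (by rintro ⟨e, rfl⟩; exact he ⟨e, rfl⟩) x hx
      rw [P.sj, P.tj]
      exact ⟨fun h => this.1 (P.glueV.j_inj h), fun h => this.2 (P.glueV.j_inj h)⟩
    -- An edge of `R₁` can meet an old node only in the interface of `r₁`, and by independence the
    -- second rule deletes no such node.
    · have key : ∀ y, P.hV y ≠ P.jV (μ₂.g.V x) (h₁₂.node_notMem x) := by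
        intro y h
        obtain ⟨k, hk, -⟩ := P.glueV.eq_iff.1 h.symm
        exact hx (h₂₁.node _ _ hk.symm)
      rw [P.sh, P.th]
      exact ⟨key _, key _⟩

/-- An elementwise description of `M` as the result of applying two rules in parallel. -/
structure DoublePresentation (μ₁ : Match r₁ G) (μ₂ : Match r₂ G) (M : PLRG.{u, v, w} 𝓛) where
  jV : ∀ y, y ∉ μ₁.deletedV → y ∉ μ₂.deletedV → M.V
  jE : ∀ e, e ∉ μ₁.deletedE → e ∉ μ₂.deletedE → M.E
  hV₁ : r₁.R.1.V → M.V
  hE₁ : r₁.R.1.E → M.E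
  hV₂ : r₂.R.1.V → M.V
  hE₂ : r₂.R.1.E → M.E
  glueV : IsDoubleGluing μ₁.deletedV μ₂.deletedV μ₁.interface.V r₁.inR.V μ₂.interface.V r₂.inR.V
    jV hV₁ hV₂
  glueE : IsDoubleGluing μ₁.deletedE μ₂.deletedE μ₁.interface.E r₁.inR.E μ₂.interface.E r₂.inR.E
    jE hE₁ hE₂
  sj : ∀ e a b, M.s (jE e a b) =
    jV (G.1.s e) (μ₁.source_not_deleted e a) (μ₂.source_not_deleted e b)
  tj : ∀ e a b, M.t (jE e a b) =
    jV (G.1.t e) (μ₁.target_not_deleted e a) (μ₂.target_not_deleted e b)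
  sh₁ : ∀ e, M.s (hE₁ e) = hV₁ (r₁.R.1.s e)
  th₁ : ∀ e, M.t (hE₁ e) = hV₁ (r₁.R.1.t e)
  sh₂ : ∀ e, M.s (hE₂ e) = hV₂ (r₂.R.1.s e)
  th₂ : ∀ e, M.t (hE₂ e) = hV₂ (r₂.R.1.t e)
  mj : ∀ e a b, M.m (jE e a b) = G.1.m e
  mh₁ : ∀ e, M.m (hE₁ e) = r₁.R.1.m e
  mh₂ : ∀ e, M.m (hE₂ e) = r₂.R.1.m e
  -- Nodes outside both interfaces suffice, since `lh₁` and `lh₂` settle the labels at interface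
  -- nodes.
  lj : ∀ y a b, (∀ k, μ₁.interface.V k ≠ y) → (∀ k, μ₂.interface.V k ≠ y) →
    M.l (jV y a b) = G.1.l y
  lh₁ : ∀ x, M.l (hV₁ x) = r₁.R.1.l x
  lh₂ : ∀ x, M.l (hV₂ x) = r₂.R.1.l x
  pj : ∀ y a b, (∀ k, μ₁.interface.V k ≠ y) → (∀ k, μ₂.interface.V k ≠ y) →
    M.p (jV y a b) = G.1.p y
  ph₁ : ∀ x, M.p (hV₁ x) = r₁.R.1.p x
  ph₂ : ∀ x, M.p (hV₂ x) = r₂.R.1.p x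

namespace DoublePresentation

variable {M N : PLRG.{u, v, w} 𝓛}

/-- The two rules play symmetric roles. -/
def swap (P : DoublePresentation μ₁ μ₂ M) : DoublePresentation μ₂ μ₁ M where
  jV y a b := P.jV y b a
  jE e a b := P.jE e b a
  hV₁ := P.hV₂
  hE₁ := P.hE₂
  hV₂ := P.hV₁
  hE₂ := P.hE₁
  glueV := P.glueV.swap
  glueE := P.glueE.swap
  sj _ _ _ := P.sj _ _ _
  tj _ _ _ := P.tj _ _ _
  sh₁ := P.sh₂
  th₁ := P.th₂
  sh₂ := P.sh₁
  th₂ := P.th₁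
  mj _ _ _ := P.mj _ _ _
  mh₁ := P.mh₂
  mh₂ := P.mh₁
  lj y _ _ a b := P.lj y _ _ b a
  lh₁ := P.lh₂
  lh₂ := P.lh₁
  pj y _ _ a b := P.pj y _ _ b a
  ph₁ := P.ph₂
  ph₂ := P.ph₁

theorem nonempty_iso (P : DoublePresentation μ₁ μ₂ M) (Q : DoublePresentation μ₁ μ₂ N) :
    Nonempty (Iso M N) := by
  -- Every node is represented, simultaneously in both covers, either by a node of a right-hand side
  -- or by a node outside both interfaces. In each case the label and rootedness are prescribed.
  have hj : ∀ y, (∃ x, y = Sum.inr x) ∨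
      (∃ x, IsDoubleGluing.cover P.jV P.hV₁ P.hV₂ y =
          IsDoubleGluing.cover P.jV P.hV₁ P.hV₂ (Sum.inr x) ∧
        IsDoubleGluing.cover Q.jV Q.hV₁ Q.hV₂ y =
          IsDoubleGluing.cover Q.jV Q.hV₁ Q.hV₂ (Sum.inr x)) ∨
      ∃ z, y = Sum.inl z ∧ (∀ k, μ₁.interface.V k ≠ z.1) ∧ ∀ k, μ₂.interface.V k ≠ z.1 := by
    rintro (y | x)
    · by_cases h₁ : ∃ k, μ₁.interface.V k = y.1
      · obtain ⟨k, hk⟩ := h₁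
        exact Or.inr (Or.inl ⟨Sum.inl (r₁.inR.V k), P.glueV.eq_iff₁.2 ⟨k, hk, rfl⟩,
          Q.glueV.eq_iff₁.2 ⟨k, hk, rfl⟩⟩)
      by_cases h₂ : ∃ k, μ₂.interface.V k = y.1
      · obtain ⟨k, hk⟩ := h₂
        exact Or.inr (Or.inl ⟨Sum.inr (r₂.inR.V k), P.glueV.eq_iff₂.2 ⟨k, hk, rfl⟩,
          Q.glueV.eq_iff₂.2 ⟨k, hk, rfl⟩⟩)
      · exact Or.inr (Or.inr ⟨y, rfl, not_exists.1 h₁, not_exists.1 h₂⟩)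
    · exact Or.inl ⟨x, rfl⟩
  have lr : ∀ x, M.l (IsDoubleGluing.cover P.jV P.hV₁ P.hV₂ (Sum.inr x)) =
      N.l (IsDoubleGluing.cover Q.jV Q.hV₁ Q.hV₂ (Sum.inr x)) := by
    rintro (x | x)
    · exact (P.lh₁ x).trans (Q.lh₁ x).symm
    · exact (P.lh₂ x).trans (Q.lh₂ x).symm
  have pr : ∀ x, M.p (IsDoubleGluing.cover P.jV P.hV₁ P.hV₂ (Sum.inr x)) =
      N.p (IsDoubleGluing.cover Q.jV Q.hV₁ Q.hV₂ (Sum.inr x)) := by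
    rintro (x | x)
    · exact (P.ph₁ x).trans (Q.ph₁ x).symm
    · exact (P.ph₂ x).trans (Q.ph₂ x).symm
  obtain ⟨φ, -⟩ := exists_iso_of_cover
    (Sum.map (fun e : {e // e ∉ μ₁.deletedE ∧ e ∉ μ₂.deletedE} =>
      (⟨G.1.s e.1, μ₁.source_not_deleted e.1 e.2.1, μ₂.source_not_deleted e.1 e.2.2⟩ :
        {y // y ∉ μ₁.deletedV ∧ y ∉ μ₂.deletedV})) (Sum.map r₁.R.1.s r₂.R.1.s))
    (Sum.map (fun e : {e // e ∉ μ₁.deletedE ∧ e ∉ μ₂.deletedE} =>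
      (⟨G.1.t e.1, μ₁.target_not_deleted e.1 e.2.1, μ₂.target_not_deleted e.1 e.2.2⟩ :
        {y // y ∉ μ₁.deletedV ∧ y ∉ μ₂.deletedV})) (Sum.map r₁.R.1.t r₂.R.1.t))
    P.glueV.surjective Q.glueV.surjective P.glueE.surjective Q.glueE.surjective
    (P.glueV.ker Q.glueV) (P.glueE.ker Q.glueE)
    (by rintro (e | e | e); exacts [P.sj _ _ _, P.sh₁ _, P.sh₂ _])
    (by rintro (e | e | e); exacts [P.tj _ _ _, P.th₁ _, P.th₂ _])
    (by rintro (e | e | e); exacts [Q.sj _ _ _, Q.sh₁ _, Q.sh₂ _])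
    (by rintro (e | e | e); exacts [Q.tj _ _ _, Q.th₁ _, Q.th₂ _])
    (by
      intro y
      rcases hj y with ⟨x, rfl⟩ | ⟨x, h, h'⟩ | ⟨z, rfl, h, h'⟩
      · exact lr x
      · rw [h, h', lr]
      · exact (P.lj _ _ _ h h').trans (Q.lj _ _ _ h h').symm)
    (by
      rintro (e | e | e)
      exacts [(P.mj _ _ _).trans (Q.mj _ _ _).symm, (P.mh₁ _).trans (Q.mh₁ _).symm,
        (P.mh₂ _).trans (Q.mh₂ _).symm])
    (by
      intro y
      rcases hj y with ⟨x, rfl⟩ | ⟨x, h, h'⟩ | ⟨z, rfl, h, h'⟩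
      · exact pr x
      · rw [h, h', pr]
      · exact (P.pj _ _ _ h h').trans (Q.pj _ _ _ h h').symm)
  exact ⟨φ⟩

end DoublePresentation

namespace Presentation

variable (P : Presentation μ₁ H.1) (h₁₂ : μ₁.Preserves μ₂) (h₂₁ : μ₂.Preserves μ₁)

theorem jV_notMem_residual {y} (hy) :
    P.jV y hy ∉ (P.residual h₁₂ h₂₁).deletedV ↔ y ∉ μ₂.deletedV := by
  refine not_congr (exists_congr fun x => and_congr_right fun _ => ?_)
  exact P.glueV.j_eq_iff

theorem jE_notMem_residual {y} (hy) :
    P.jE y hy ∉ (P.residual h₁₂ h₂₁).deletedE ↔ y ∉ μ₂.deletedE := by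
  refine not_congr (exists_congr fun x => and_congr_right fun _ => ?_)
  exact P.glueE.j_eq_iff

theorem hV_notMem_residual (x) : P.hV x ∉ (P.residual h₁₂ h₂₁).deletedV := by
  rintro ⟨y, hy, e⟩
  obtain ⟨k, hk, -⟩ := P.glueV.eq_iff.1 e
  exact hy (h₂₁.node _ _ hk.symm)

theorem hE_notMem_residual (x) : P.hE x ∉ (P.residual h₁₂ h₂₁).deletedE := by
  rintro ⟨y, hy, e⟩
  obtain ⟨k, hk, -⟩ := P.glueE.eq_iff.1 e
  exact hy (h₂₁.edge _ _ hk.symm)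

theorem exists_of_residual_interface {k x} (h : (P.residual h₁₂ h₂₁).interface.V k = P.hV x) :
    ∃ k₁, μ₁.interface.V k₁ = μ₂.interface.V k :=
  let ⟨k₁, h, _⟩ := P.glueV.eq_iff.1 h
  ⟨k₁, h⟩

/-- A step followed by the residual of an independent step is a parallel application. -/
def double {M : PLRG.{u, v, w} 𝓛} (Q : Presentation (P.residual h₁₂ h₂₁) M) :
    DoublePresentation μ₁ μ₂ M where
  jV y a b := Q.jV (P.jV y a) ((P.jV_notMem_residual h₁₂ h₂₁ a).2 b)
  jE y a b := Q.jE (P.jE y a) ((P.jE_notMem_residual h₁₂ h₂₁ a).2 b)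
  hV₁ x := Q.jV (P.hV x) (P.hV_notMem_residual h₁₂ h₂₁ x)
  hE₁ x := Q.jE (P.hE x) (P.hE_notMem_residual h₁₂ h₂₁ x)
  hV₂ := Q.hV
  hE₂ := Q.hE
  glueV := P.glueV.double Q.glueV (fun _ hy => P.jV_notMem_residual h₁₂ h₂₁ hy) _
    (fun k => h₁₂.node_notMem (r₂.inL.V k)) (fun _ => rfl)
  glueE := P.glueE.double Q.glueE (fun _ hy => P.jE_notMem_residual h₁₂ h₂₁ hy) _
    (fun k => h₁₂.edge_notMem (r₂.inL.E k)) (fun _ => rfl)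
  sj e a b := by rw [Q.sj]; exact Q.jV_congr (P.sj _ _) _ _
  tj e a b := by rw [Q.tj]; exact Q.jV_congr (P.tj _ _) _ _
  sh₁ e := by rw [Q.sj]; exact Q.jV_congr (P.sh _) _ _
  th₁ e := by rw [Q.tj]; exact Q.jV_congr (P.th _) _ _
  sh₂ := Q.sh
  th₂ := Q.th
  mj e a b := by rw [Q.mj, P.mj]
  mh₁ e := by rw [Q.mj, P.mh]
  mh₂ := Q.mh
  lj y a b h h' := by
    rw [Q.lj _ _ fun k hk => (h' k (P.glueV.j_inj hk)).elim, P.lj _ _ fun k hk => (h k hk).elim]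
  lh₁ x := by
    -- A node of `R₁` hit by the residual interface comes from both interfaces in `G`, so
    -- independence prevents `r₂` from relabelling it.
    rw [Q.lj _ _ fun k hk => ?_, P.lh]
    obtain ⟨k₁, hk₁⟩ := P.exists_of_residual_interface h₁₂ h₂₁ hk
    exact h₂₁.label k _ hk₁.symm
  lh₂ := Q.lh
  pj y a b h h' := by
    rw [Q.pj _ _ fun k hk => (h' k (P.glueV.j_inj hk)).elim, P.pj _ _ fun k hk => (h k hk).elim]
  ph₁ x := by
    rw [Q.pj _ _ fun k hk => ?_, P.ph]
    obtain ⟨k₁, hk₁⟩ := P.exists_of_residual_interface h₁₂ h₂₁ hk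
    exact h₂₁.root k _ hk₁.symm
  ph₂ := Q.ph

end Presentation

/-- Independent steps commute. -/
theorem Match.Preserves.exists_common_result {H₁ H₂ : TLRG.{u, v, w} 𝓛}
    (P₁ : Presentation μ₁ H₁.1) (P₂ : Presentation μ₂ H₂.1) (h₁₂ : μ₁.Preserves μ₂)
    (h₂₁ : μ₂.Preserves μ₁) :
    ∃ M : TLRG.{u, v, w} 𝓛,
      Nonempty (DirectDerivation r₂ H₁ M) ∧ Nonempty (DirectDerivation r₁ H₂ M) := by
  -- Both orders of application are parallel applications of the same two matches, up to exchanging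
  -- their roles.
  obtain ⟨φ⟩ := (P₂.double h₂₁ h₁₂ (Match.presentation _)).nonempty_iso
    (P₁.double h₁₂ h₂₁ (Match.presentation _)).swap
  exact ⟨(P₁.residual h₁₂ h₂₁).result, ⟨⟨_, Iso.refl _⟩⟩, ⟨⟨_, φ⟩⟩⟩

end Commutation

/-! ### Transport along isomorphisms of the start graph -/

section Transport

variable {r : Rule.{u, v, w} 𝓛} {G G' : TLRG.{u, v, w} 𝓛} {M : PLRG.{u, v, w} 𝓛}

/-- The image of a match under an isomorphism. -/
def Match.map (μ : Match r G) (φ : Iso G.1 G'.1) : Match r G' where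
  g := φ.hom.comp μ.g
  injective := ⟨φ.equivV.injective.comp μ.injective.1, φ.equivE.injective.comp μ.injective.2⟩
  dangling e he x hx := by
    have := μ.dangling (φ.inv.E e)
      (by rintro ⟨f, hf⟩; exact he ⟨f, (congrArg φ.hom.E hf).trans (φ.hom_inv_E e)⟩) x hx
    rw [← φ.inv.source, ← φ.inv.target] at this
    exact ⟨fun h => this.1 ((congrArg φ.inv.V h).trans (φ.inv_hom_V _)),
      fun h => this.2 ((congrArg φ.inv.V h).trans (φ.inv_hom_V _))⟩

theorem Match.hom_notMem_map {μ : Match r G} {φ : Iso G.1 G'.1} (x) (h : x ∉ μ.deletedV) :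
    φ.hom.V x ∉ (μ.map φ).deletedV := by
  rintro ⟨y, hy, e⟩
  exact h ⟨y, hy, φ.equivV.injective e⟩

theorem Match.hom_notMem_mapE {μ : Match r G} {φ : Iso G.1 G'.1} (x) (h : x ∉ μ.deletedE) :
    φ.hom.E x ∉ (μ.map φ).deletedE := by
  rintro ⟨y, hy, e⟩
  exact h ⟨y, hy, φ.equivE.injective e⟩

theorem Match.inv_notMem {μ : Match r G} {φ : Iso G.1 G'.1} (y) (h : y ∉ (μ.map φ).deletedV) :
    φ.inv.V y ∉ μ.deletedV := by
  rintro ⟨x, hx, e⟩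
  exact h ⟨x, hx, (congrArg φ.hom.V e).trans (φ.hom_inv_V y)⟩

theorem Match.inv_notMemE {μ : Match r G} {φ : Iso G.1 G'.1} (y) (h : y ∉ (μ.map φ).deletedE) :
    φ.inv.E y ∉ μ.deletedE := by
  rintro ⟨x, hx, e⟩
  exact h ⟨x, hx, (congrArg φ.hom.E e).trans (φ.hom_inv_E y)⟩

/-- Presentations transport along isomorphisms of the start graph. -/
def Presentation.congrSource {μ : Match r G} (P : Presentation μ M) (φ : Iso G.1 G'.1) :
    Presentation (μ.map φ) M where
  jV y hy := P.jV (φ.inv.V y) (Match.inv_notMem y hy)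
  jE y hy := P.jE (φ.inv.E y) (Match.inv_notMemE y hy)
  hV := P.hV
  hE := P.hE
  glueV := P.glueV.congr_source φ.equivV (fun _ => rfl) Match.inv_notMem Match.hom_notMem_map
  glueE := P.glueE.congr_source φ.equivE (fun _ => rfl) Match.inv_notMemE Match.hom_notMem_mapE
  sj e he := by rw [P.sj]; exact P.jV_congr (φ.inv.source e).symm _ _
  tj e he := by rw [P.tj]; exact P.jV_congr (φ.inv.target e).symm _ _
  sh := P.sh
  th := P.th
  mj e he := by rw [P.mj, ← φ.inv.edgeLabel]
  mh := P.mh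
  lj y hy h := by
    rw [P.lj _ _ fun k hk => h k ((congrArg φ.hom.V hk).trans (φ.hom_inv_V y))]
    exact φ.symm.l_hom y
  lh := P.lh
  pj y hy h := by
    rw [P.pj _ _ fun k hk => h k ((congrArg φ.hom.V hk).trans (φ.hom_inv_V y))]
    exact φ.symm.p_hom y
  ph := P.ph

/-- A derivation admits an explicit isomorphism only at its end, so one at the start is absorbed
into the first step by moving its match. -/
theorem Derivation.nonempty_of_iso {T : GTSystem.{u, v, w} 𝓛} {M : TLRG.{u, v, w} 𝓛}
    (δ : Derivation T G M) (φ : Iso G'.1 G.1) : Nonempty (Derivation T G' M) := by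
  cases δ with
  | iso f => exact ⟨.iso (φ.trans f)⟩
  | step r hr d ds =>
    obtain ⟨d'⟩ := (d.presentation.congrSource φ.symm).nonempty_directDerivation
    exact ⟨.step r hr d' ds⟩

end Transport

/-! ### Contexts -/

/-- A context with boundary `B`: nodes and edges to be attached to a graph with a map from `B` to
its nodes. -/
structure Context (𝓛 : LabelAlphabet.{u, v}) (B : Type w) where
  V : Type w
  E : Type w
  finite_V : Finite V
  finite_E : Finite E
  s : E → B ⊕ V
  t : E → B ⊕ V
  l : V → 𝓛.NodeLabel
  m : E → 𝓛.EdgeLabel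
  p : V → ZMod 2

namespace Context

variable {B : Type w} (C : Context.{u, v, w} 𝓛 B)

/-- Attach a context to a graph. -/
def attach (A : TLRG.{u, v, w} 𝓛) (f : B → A.1.V) : TLRG.{u, v, w} 𝓛 where
  val :=
    { V := A.1.V ⊕ C.V
      E := A.1.E ⊕ C.E
      finite_V := haveI := A.1.finite_V; haveI := C.finite_V; inferInstance
      finite_E := haveI := A.1.finite_E; haveI := C.finite_E; inferInstance
      s := Sum.elim (fun e => Sum.inl (A.1.s e)) (fun e => Sum.map f (fun x => x) (C.s e))
      t := Sum.elim (fun e => Sum.inl (A.1.t e)) (fun e => Sum.map f (fun x => x) (C.t e))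
      l := Sum.elim A.1.l (fun x => some (C.l x))
      m := Sum.elim A.1.m C.m
      p := Sum.elim A.1.p (fun x => some (C.p x)) }
  property := ⟨by rintro (x | x); exacts [A.2.1 x, rfl], by rintro (x | x); exacts [A.2.2 x, rfl]⟩

/-- Attaching a context respects isomorphisms. -/
def attachIso {A A' : TLRG.{u, v, w} 𝓛} {f : B → A.1.V} {f' : B → A'.1.V} (φ : Iso A.1 A'.1)
    (h : ∀ b, φ.hom.V (f b) = f' b) : Iso (C.attach A f).1 (C.attach A' f').1 :=
  Iso.ofEquiv (Equiv.sumCongr φ.equivV (Equiv.refl C.V)) (Equiv.sumCongr φ.equivE (Equiv.refl C.E))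
    (by
      rintro (e | e)
      · exact congrArg Sum.inl (φ.hom.source e)
      · change Sum.map φ.hom.V _ (Sum.map f _ (C.s e)) = Sum.map f' _ (C.s e)
        rcases C.s e with b | x
        exacts [congrArg Sum.inl (h b), rfl])
    (by
      rintro (e | e)
      · exact congrArg Sum.inl (φ.hom.target e)
      · change Sum.map φ.hom.V _ (Sum.map f _ (C.t e)) = Sum.map f' _ (C.t e)
        rcases C.t e with b | x
        exacts [congrArg Sum.inl (h b), rfl])
    (by rintro (x | x); exacts [(φ.l_hom x).symm, rfl])
    (by rintro (x | x); exacts [φ.hom.edgeLabel x, rfl])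
    (by rintro (x | x); exacts [(φ.p_hom x).symm, rfl])

variable {r : Rule.{u, v, w} 𝓛} {A : TLRG.{u, v, w} 𝓛} (μ : Match r A) (f : B → A.1.V)

/-- A match in a graph is a match in the graph with a context attached to nodes that are not
deleted. -/
def attachMatch (hf : ∀ b, f b ∉ μ.deletedV) : Match r (C.attach A f) where
  g :=
    { V := fun x => Sum.inl (μ.g.V x)
      E := fun e => Sum.inl (μ.g.E e)
      source := fun e => congrArg Sum.inl (μ.g.source e)
      target := fun e => congrArg Sum.inl (μ.g.target e)
      edgeLabel := μ.g.edgeLabel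
      nodeLabel := μ.g.nodeLabel
      rootedness := μ.g.rootedness }
  injective := ⟨Sum.inl_injective.comp μ.injective.1, Sum.inl_injective.comp μ.injective.2⟩
  dangling := by
    rintro (e | e) he x hx
    · have := μ.dangling e (by rintro ⟨e, rfl⟩; exact he ⟨e, rfl⟩) x hx
      exact ⟨fun h => this.1 (Sum.inl_injective h), fun h => this.2 (Sum.inl_injective h)⟩
    -- Context edges reach `A` only through boundary nodes, which are not deleted.
    · have key : ∀ y, Sum.map f (fun x => x) y ≠ (Sum.inl (μ.g.V x) : A.1.V ⊕ C.V) := by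
        rintro (b | y) h
        · exact hf b ⟨x, hx, (Sum.inl_injective h).symm⟩
        · cases h
      exact ⟨key _, key _⟩

variable {μ f} {hf : ∀ b, f b ∉ μ.deletedV}

theorem inl_notMem_attachMatch (y) : Sum.inl y ∉ (C.attachMatch μ f hf).deletedV ↔
    y ∉ μ.deletedV :=
  not_congr (exists_congr fun _ => and_congr_right fun _ => Sum.inl_injective.eq_iff)

theorem inl_notMem_attachMatchE (y) : Sum.inl y ∉ (C.attachMatch μ f hf).deletedE ↔
    y ∉ μ.deletedE :=
  not_congr (exists_congr fun _ => and_congr_right fun _ => Sum.inl_injective.eq_iff)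

theorem inr_notMem_attachMatch (y) : Sum.inr y ∉ (C.attachMatch μ f hf).deletedV := by
  rintro ⟨x, -, h⟩
  cases h

theorem inr_notMem_attachMatchE (y) : Sum.inr y ∉ (C.attachMatch μ f hf).deletedE := by
  rintro ⟨x, -, h⟩
  cases h

variable (hf) in
/-- Rule application commutes with attaching a context. -/
def attachPresentation {M : TLRG.{u, v, w} 𝓛} (P : Presentation μ M.1) :
    Presentation (C.attachMatch μ f hf) (C.attach M fun b => P.jV (f b) (hf b)).1 where
  jV := IsGluing.sumMap P.jV fun y => (C.inl_notMem_attachMatch y).1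
  jE := IsGluing.sumMap P.jE fun y => (C.inl_notMem_attachMatchE y).1
  hV x := Sum.inl (P.hV x)
  hE x := Sum.inl (P.hE x)
  glueV := P.glueV.sum (fun _ => rfl) (fun y => (C.inl_notMem_attachMatch y).1)
    (fun y => (C.inl_notMem_attachMatch y).2) C.inr_notMem_attachMatch
  glueE := P.glueE.sum (fun _ => rfl) (fun y => (C.inl_notMem_attachMatchE y).1)
    (fun y => (C.inl_notMem_attachMatchE y).2) C.inr_notMem_attachMatchE
  sj := by
    rintro (e | e) he
    · exact congrArg Sum.inl (P.sj e _)
    · have key : ∀ y hy, Sum.map (fun b => P.jV (f b) (hf b)) (fun x => x) y =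
          IsGluing.sumMap P.jV (fun y => (C.inl_notMem_attachMatch (hf := hf) y).1)
            (Sum.map f (fun x => x) y) hy := by
        rintro (b | y) hy <;> rfl
      exact key _ _
  tj := by
    rintro (e | e) he
    · exact congrArg Sum.inl (P.tj e _)
    · have key : ∀ y hy, Sum.map (fun b => P.jV (f b) (hf b)) (fun x => x) y =
          IsGluing.sumMap P.jV (fun y => (C.inl_notMem_attachMatch (hf := hf) y).1)
            (Sum.map f (fun x => x) y) hy := by
        rintro (b | y) hy <;> rfl
      exact key _ _
  sh e := congrArg Sum.inl (P.sh e)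
  th e := congrArg Sum.inl (P.th e)
  mj := by rintro (e | e) he; exacts [P.mj _ _, rfl]
  mh := P.mh
  lj := by
    rintro (y | y) hy h
    exacts [P.lj _ _ fun k hk => h k (congrArg Sum.inl hk), rfl]
  lh := P.lh
  pj := by
    rintro (y | y) hy h
    exacts [P.pj _ _ fun k hk => h k (congrArg Sum.inl hk), rfl]
  ph := P.ph

/-- A step extends to a graph with a context attached to tracked nodes. -/
theorem exists_presentation_of_track {H : TLRG.{u, v, w} 𝓛} (d : DirectDerivation r A H)
    {f : B → A.1.V} {f' : B → H.1.V} (h : ∀ b, f' b ∈ d.track (f b)) :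
    ∃ hf, Nonempty (Presentation (C.attachMatch d.μ f hf) (C.attach H f').1) := by
  have hf : ∀ b, f b ∉ d.μ.deletedV := fun b => (h b).fst
  have e : f' = fun b => d.presentation.jV (f b) (hf b) := funext fun b => (h b).snd.symm
  exact ⟨hf, e ▸ ⟨C.attachPresentation hf d.presentation⟩⟩

/-- A derivation extends to a graph with a context attached to tracked nodes. -/
theorem nonempty_derivation_attach {T : GTSystem.{u, v, w} 𝓛} {A M : TLRG.{u, v, w} 𝓛}
    (δ : Derivation T A M) {f : B → A.1.V} {f' : B → M.1.V} (h : ∀ b, f' b ∈ δ.track (f b)) :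
    Nonempty (Derivation T (C.attach A f) (C.attach M f')) := by
  induction δ with
  | iso φ => exact ⟨.iso (C.attachIso φ fun b => (Part.mem_some_iff.1 (h b)).symm)⟩
  | step r hr d ds ih =>
    -- Definedness of the composite track supplies the attachment map at the intermediate graph.
    have h' : ∀ b, ∃ c ∈ d.track (f b), f' b ∈ ds.track c := fun b => Part.mem_bind_iff.1 (h b)
    choose c hc hc' using h'
    obtain ⟨hf, ⟨P⟩⟩ := C.exists_presentation_of_track d hc
    obtain ⟨d'⟩ := P.nonempty_directDerivation
    obtain ⟨δ'⟩ := ih hc'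
    exact ⟨.step r hr d' δ'⟩

end Context

/-! ### Complements of subgraphs -/

theorem bijective_elim_val {α β : Type*} {f : α → β} (hf : Function.Injective f) :
    Function.Bijective (Sum.elim f (Subtype.val : {y // y ∉ Set.range f} → β)) := by
  refine ⟨?_, fun y => ?_⟩
  · rintro (x | ⟨x, hx⟩) (y | ⟨y, hy⟩) h
    · exact congrArg _ (hf h)
    · exact (hy ⟨x, h⟩).elim
    · exact (hx ⟨y, h.symm⟩).elim
    · exact congrArg Sum.inr (Subtype.ext h)
  · by_cases hy : y ∈ Set.range f
    · obtain ⟨x, rfl⟩ := hy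
      exact ⟨Sum.inl x, rfl⟩
    · exact ⟨Sum.inr ⟨y, hy⟩, rfl⟩

/-- A graph decomposes into a subgraph and a context, whose boundary may be any set of nodes that
contains the subgraph's nodes incident to edges outside the subgraph. -/
theorem exists_context {S G : TLRG.{u, v, w} 𝓛} (ι : Hom S.1 G.1) (hι : ι.Injective) (B : Set S.1.V)
    (hB : ∀ e, e ∉ Set.range ι.E → ∀ x, G.1.s e = ι.V x ∨ G.1.t e = ι.V x → x ∈ B) :
    ∃ (C : Context.{u, v, w} 𝓛 B) (φ : Iso (C.attach S Subtype.val).1 G.1),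
      (∀ x, φ.hom.V (Sum.inl x) = ι.V x) ∧ ∀ e, φ.hom.E (Sum.inl e) = ι.E e := by
  classical
  -- An endpoint of an outside edge is either outside the subgraph or, by `hB`, in the boundary;
  -- this provides the ends of context edges.
  have end_cases : ∀ (e : {e // e ∉ Set.range ι.E}) (y : G.1.V), G.1.s e.1 = y ∨ G.1.t e.1 = y →
      ∃ z : B ⊕ {y // y ∉ Set.range ι.V},
        Sum.elim ι.V Subtype.val (Sum.map Subtype.val (fun x => x) z) = y := by
    intro e y hy
    by_cases h : y ∈ Set.range ι.V
    · obtain ⟨x, rfl⟩ := h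
      exact ⟨Sum.inl ⟨x, hB e.1 e.2 x hy⟩, rfl⟩
    · exact ⟨Sum.inr ⟨y, h⟩, rfl⟩
  choose s hs using fun e => end_cases e _ (Or.inl rfl)
  choose t ht using fun e => end_cases e _ (Or.inr rfl)
  have hl : ∀ x a, S.1.l x = a → G.1.l (ι.V x) = a := by
    rintro x a rfl
    obtain ⟨a, ha⟩ := Option.isSome_iff_exists.1 (S.2.1 x)
    rw [ha, ι.nodeLabel x a ha]
  have hp : ∀ x a, S.1.p x = a → G.1.p (ι.V x) = a := by
    rintro x a rfl
    obtain ⟨a, ha⟩ := Option.isSome_iff_exists.1 (S.2.2 x)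
    rw [ha, ι.rootedness x a ha]
  refine ⟨
    { V := {y // y ∉ Set.range ι.V}
      E := {e // e ∉ Set.range ι.E}
      finite_V := haveI := G.1.finite_V; inferInstance
      finite_E := haveI := G.1.finite_E; inferInstance
      s := s
      t := t
      l := fun y => (G.1.l y.1).get (G.2.1 _)
      m := fun e => G.1.m e.1
      p := fun y => (G.1.p y.1).get (G.2.2 _) },
    Iso.ofEquiv (Equiv.ofBijective _ (bijective_elim_val hι.1))
      (Equiv.ofBijective _ (bijective_elim_val hι.2)) ?_ ?_ ?_ ?_ ?_,
    fun _ => rfl, fun _ => rfl⟩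
  · rintro (e | e)
    exacts [ι.source e, hs e]
  · rintro (e | e)
    exacts [ι.target e, ht e]
  · rintro (x | x)
    exacts [(hl x _ rfl).symm, Option.some_get _]
  · rintro (e | e)
    exacts [ι.edgeLabel e, rfl]
  · rintro (x | x)
    exacts [(hp x _ rfl).symm, Option.some_get _]

/-! ### Restriction to the union of two matches -/

/-- A match restricts to a subgraph through which it factors. -/
def Match.factor {r : Rule.{u, v, w} 𝓛} {S G : TLRG.{u, v, w} 𝓛} (μ : Match r G) (ι : Hom S.1 G.1)
    (hι : ι.Injective) (g : Hom r.L.1 S.1) (h : ι.comp g = μ.g) : Match r S where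
  g := g
  injective :=
    ⟨Function.Injective.of_comp (f := ι.V) (by have := μ.injective.1; rwa [← h] at this),
      Function.Injective.of_comp (f := ι.E) (by have := μ.injective.2; rwa [← h] at this)⟩
  dangling e he x hx := by
    have := μ.dangling (ι.E e)
      (by rw [← h]; rintro ⟨f, hf⟩; exact he ⟨f, hι.2 hf⟩) x hx
    rw [← ι.source, ← ι.target, ← h] at this
    exact ⟨fun e => this.1 (congrArg ι.V e), fun e => this.2 (congrArg ι.V e)⟩

/-- Morphisms act on items. -/
def Item.map {G H : PLRG.{u, v, w} 𝓛} (f : Hom G H) : Item G → Item H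
  | .node x => .node (f.V x)
  | .edge e => .edge (f.E e)
  | .label x => .label (f.V x)
  | .root x => .root (f.V x)

theorem Item.map_injective {G H : PLRG.{u, v, w} 𝓛} {f : Hom G H} (hf : f.Injective) :
    Function.Injective (Item.map f) := by
  rintro (x | x | x | x) (y | y | y | y) h <;> simp only [Item.map, reduceCtorEq] at h <;>
    injection h with h
  exacts [congrArg _ (hf.1 h), congrArg _ (hf.2 h), congrArg _ (hf.1 h), congrArg _ (hf.1 h)]

theorem Hom.image_comp {G H M : PLRG.{u, v, w} 𝓛} (g : Hom H M) (f : Hom G H) :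
    (g.comp f).image = Item.map g '' f.image := by
  ext i
  constructor
  · rintro (⟨x, rfl⟩ | ⟨x, rfl⟩ | ⟨x, h, rfl⟩ | ⟨x, h, rfl⟩)
    · exact ⟨.node (f.V x), Or.inl ⟨x, rfl⟩, rfl⟩
    · exact ⟨.edge (f.E x), Or.inr (Or.inl ⟨x, rfl⟩), rfl⟩
    · exact ⟨.label (f.V x), Or.inr (Or.inr (Or.inl ⟨x, h, rfl⟩)), rfl⟩
    · exact ⟨.root (f.V x), Or.inr (Or.inr (Or.inr ⟨x, h, rfl⟩)), rfl⟩
  · rintro ⟨i, ⟨x, rfl⟩ | ⟨x, rfl⟩ | ⟨x, h, rfl⟩ | ⟨x, h, rfl⟩, rfl⟩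
    · exact Or.inl ⟨x, rfl⟩
    · exact Or.inr (Or.inl ⟨x, rfl⟩)
    · exact Or.inr (Or.inr (Or.inl ⟨x, h, rfl⟩))
    · exact Or.inr (Or.inr (Or.inr ⟨x, h, rfl⟩))

theorem Hom.mem_image_of_V {G H : PLRG.{u, v, w} 𝓛} (hG : G.IsTLRG) (f : Hom G H) {y}
    (h : y ∈ Set.range f.V) :
    Item.node y ∈ f.image ∧ Item.label y ∈ f.image ∧ Item.root y ∈ f.image := by
  obtain ⟨x, rfl⟩ := h
  exact ⟨Or.inl ⟨x, rfl⟩, Or.inr (Or.inr (Or.inl ⟨x, hG.1 x, rfl⟩)),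
    Or.inr (Or.inr (Or.inr ⟨x, hG.2 x, rfl⟩))⟩

/-- The image of a totally labelled and rooted graph contains the label and root of each of its
nodes, so covering nodes and edges is enough. -/
theorem items_eq_union {A B G : PLRG.{u, v, w} 𝓛} (hA : A.IsTLRG) (hB : B.IsTLRG)
    (hG : G.IsTLRG) {f : Hom A G} {g : Hom B G} (hV : ∀ y, y ∈ Set.range f.V ∪ Set.range g.V)
    (hE : ∀ y, y ∈ Set.range f.E ∪ Set.range g.E) : G.items = f.image ∪ g.image := by
  ext i
  constructor
  · intro _
    rcases i with y | e | y | y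
    · exact (hV y).imp (fun h => (f.mem_image_of_V hA h).1) fun h => (g.mem_image_of_V hB h).1
    · refine (hE e).imp ?_ ?_ <;> rintro ⟨x, rfl⟩ <;> exact Or.inr (Or.inl ⟨x, rfl⟩)
    · exact (hV y).imp (fun h => (f.mem_image_of_V hA h).2.1) fun h => (g.mem_image_of_V hB h).2.1
    · exact (hV y).imp (fun h => (f.mem_image_of_V hA h).2.2) fun h => (g.mem_image_of_V hB h).2.2
  · intro _
    rcases i with y | e | y | y
    · exact Or.inl ⟨y, rfl⟩
    · exact Or.inr (Or.inl ⟨e, rfl⟩)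
    · exact Or.inr (Or.inr (Or.inl ⟨y, hG.1 y, rfl⟩))
    · exact Or.inr (Or.inr (Or.inr ⟨y, hG.2 y, rfl⟩))

/-- Two morphisms into a graph factor, jointly surjectively, through a subgraph. -/
theorem exists_union {A B : PLRG.{u, v, w} 𝓛} {G : TLRG.{u, v, w} 𝓛} (f : Hom A G.1)
    (g : Hom B G.1) : ∃ (S : TLRG.{u, v, w} 𝓛) (ι : Hom S.1 G.1) (f' : Hom A S.1) (g' : Hom B S.1),
      ι.Injective ∧ ι.UndefinednessPreserving ∧ ι.comp f' = f ∧ ι.comp g' = g ∧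
      (∀ y, y ∈ Set.range f'.V ∪ Set.range g'.V) ∧ ∀ y, y ∈ Set.range f'.E ∪ Set.range g'.E := by
  let S : TLRG.{u, v, w} 𝓛 :=
    ⟨{ V := {y // y ∈ Set.range f.V ∪ Set.range g.V}
       E := {y // y ∈ Set.range f.E ∪ Set.range g.E}
       finite_V := haveI := G.1.finite_V; inferInstance
       finite_E := haveI := G.1.finite_E; inferInstance
       s := fun e => ⟨G.1.s e.1, by
         obtain ⟨_, ⟨x, rfl⟩ | ⟨x, rfl⟩⟩ := e
         exacts [Or.inl ⟨_, f.source x⟩, Or.inr ⟨_, g.source x⟩]⟩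
       t := fun e => ⟨G.1.t e.1, by
         obtain ⟨_, ⟨x, rfl⟩ | ⟨x, rfl⟩⟩ := e
         exacts [Or.inl ⟨_, f.target x⟩, Or.inr ⟨_, g.target x⟩]⟩
       l := fun y => G.1.l y.1
       m := fun e => G.1.m e.1
       p := fun y => G.1.p y.1 }, fun _ => G.2.1 _, fun _ => G.2.2 _⟩
  refine ⟨S, ⟨Subtype.val, Subtype.val, fun _ => rfl, fun _ => rfl, fun _ => rfl, fun _ _ h => h,
      fun _ _ h => h⟩,
    ⟨fun x => ⟨f.V x, Or.inl ⟨x, rfl⟩⟩, fun x => ⟨f.E x, Or.inl ⟨x, rfl⟩⟩,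
      fun e => Subtype.ext (f.source e), fun e => Subtype.ext (f.target e), f.edgeLabel,
      f.nodeLabel, f.rootedness⟩,
    ⟨fun x => ⟨g.V x, Or.inr ⟨x, rfl⟩⟩, fun x => ⟨g.E x, Or.inr ⟨x, rfl⟩⟩,
      fun e => Subtype.ext (g.source e), fun e => Subtype.ext (g.target e), g.edgeLabel,
      g.nodeLabel, g.rootedness⟩,
    ⟨Subtype.val_injective, Subtype.val_injective⟩, ⟨fun _ => rfl, fun _ => rfl⟩, rfl, rfl, ?_, ?_⟩
  · rintro ⟨_, ⟨x, rfl⟩ | ⟨x, rfl⟩⟩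
    exacts [Or.inl ⟨x, rfl⟩, Or.inr ⟨x, rfl⟩]
  · rintro ⟨_, ⟨x, rfl⟩ | ⟨x, rfl⟩⟩
    exacts [Or.inl ⟨x, rfl⟩, Or.inr ⟨x, rfl⟩]

theorem subgraphClosure_of_isSubgraph {D : Set (AbstractTLRG.{u, v, w} 𝓛)} {S G : TLRG.{u, v, w} 𝓛}
    (h : IsSubgraph S.1 G.1) (hG : G.cls ∈ D) : S.cls ∈ subgraphClosure D :=
  fun _ ⟨hD, hc⟩ => hc G S h (hD hG)

/-! ### The critical pair lemma -/

/-- A step inside a subgraph followed by a derivation extends to the whole graph, provided that the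
boundary of the subgraph is tracked. -/
theorem nonempty_derivation_of_factor {T : GTSystem.{u, v, w} 𝓛} {r : Rule.{u, v, w} 𝓛}
    {S S' G H M : TLRG.{u, v, w} 𝓛} (ι : Hom S.1 G.1) {B : Type w} {C : Context.{u, v, w} 𝓛 B}
    {f : B → S.1.V} (φ : Iso (C.attach S f).1 G.1) (hφV : ∀ x, φ.hom.V (Sum.inl x) = ι.V x)
    (hφE : ∀ e, φ.hom.E (Sum.inl e) = ι.E e) (d : DirectDerivation r S S')
    (δ : Derivation T S' M) (d' : DirectDerivation r G H) (hd : ι.comp d.μ.g = d'.μ.g)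
    {f' : B → M.1.V} (h : ∀ b, f' b ∈ (δ.track.comp d.track) (f b)) :
    Nonempty (Derivation T H (C.attach M f')) := by
  have h' : ∀ b, ∃ c ∈ d.track (f b), f' b ∈ δ.track c := fun b => Part.mem_bind_iff.1 (h b)
  choose c hc hc' using h'
  obtain ⟨hf, ⟨P⟩⟩ := C.exists_presentation_of_track d hc
  obtain ⟨δ'⟩ := C.nonempty_derivation_attach δ hc'
  -- Extended to the attached context and moved along `φ`, the small match is the given one, so
  -- uniqueness of results identifies `H` with the context attached to `S'`.
  have e : (C.attachMatch d.μ f hf).map φ = d'.μ := by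
    refine Match.ext_g ?_
    rw [← hd]
    ext x
    · exact hφV _
    · exact hφE _
  obtain ⟨ψ, -⟩ := d'.presentation.exists_iso (e ▸ P.congrSource φ)
  exact δ'.nonempty_of_iso ψ

theorem locallyConfluentOn_of_stronglyJoinable {T : GTSystem.{u, v, w} 𝓛}
    {D : Set (AbstractTLRG.{u, v, w} 𝓛)}
    (h : ∀ Φ : DerivationPair T, Φ.IsCritical → Φ.NonGarbage D → Φ.StronglyJoinable) :
    T.LocallyConfluentOn D := by
  rintro G H₁ H₂ hG ⟨r₁, hr₁, ⟨d₁⟩⟩ ⟨r₂, hr₂, ⟨d₂⟩⟩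
  -- This case must be separated because a critical pair requires distinct matches when the rules
  -- are equal.
  by_cases heq : (⟨r₁, d₁.μ⟩ : Σ r, Match r G) = ⟨r₂, d₂.μ⟩
  · obtain ⟨μ₁, φ₁⟩ := d₁
    obtain ⟨μ₂, φ₂⟩ := d₂
    cases heq
    exact ⟨H₁, ⟨.iso (Iso.refl _)⟩, ⟨.iso (φ₂.symm.trans φ₁)⟩⟩
  by_cases hind : d₁.μ.g.image ∩ d₂.μ.g.image ⊆ d₁.μ.interface.image ∩ d₂.μ.interface.image
  · obtain ⟨M, ⟨e₁⟩, ⟨e₂⟩⟩ := Match.Preserves.exists_common_result d₁.presentation d₂.presentation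
      (.of_subset fun _ hi => (hind hi).1) (.of_subset fun _ hi => (hind hi.symm).2)
    exact ⟨M, ⟨.step r₂ hr₂ e₁ (.iso (Iso.refl _))⟩, ⟨.step r₁ hr₁ e₂ (.iso (Iso.refl _))⟩⟩
  obtain ⟨S, ι, g₁, g₂, hι, hu, hg₁, hg₂, hV, hE⟩ := exists_union d₁.μ.g d₂.μ.g
  let ν₁ := d₁.μ.factor ι hι g₁ hg₁
  let ν₂ := d₂.μ.factor ι hι g₂ hg₂
  let Φ : DerivationPair T := ⟨S, ν₁.result, ν₂.result, r₁, r₂, hr₁, hr₂, ⟨ν₁, Iso.refl _⟩,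
    ⟨ν₂, Iso.refl _⟩⟩
  have hcrit : Φ.IsCritical :=
    { cover := items_eq_union r₁.L.2 r₂.L.2 S.2 hV hE
      -- All images in `G` are images under the injective `ι` of those in `S`, and injective maps
      -- preserve intersections; independence in `S` would thus pass to `G`.
      not_independent := by
        intro hΦ
        apply hind
        have e₁ : d₁.μ.interface = ι.comp ν₁.interface := by
          rw [Match.interface, ← hg₁]; rfl
        have e₂ : d₂.μ.interface = ι.comp ν₂.interface := by
          rw [Match.interface, ← hg₂]; rfl
        rw [← hg₁, ← hg₂, e₁, e₂, Hom.image_comp, Hom.image_comp, Hom.image_comp, Hom.image_comp,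
          ← Set.image_inter (Item.map_injective hι), ← Set.image_inter (Item.map_injective hι)]
        exact Set.image_mono hΦ
      distinct := by
        intro hΦ
        apply heq
        have := congrArg (fun x : Σ r, Match r S => (⟨x.1, ι.comp x.2.g⟩ : Σ r : Rule 𝓛,
          Hom r.L.1 G.1)) hΦ
        change (⟨r₁, ι.comp g₁⟩ : Σ r : Rule 𝓛, Hom r.L.1 G.1) = ⟨r₂, ι.comp g₂⟩ at this
        rw [hg₁, hg₂] at this
        clear_value Φ
        obtain ⟨rfl, hg⟩ := Sigma.mk.inj_iff.1 this
        rw [Match.ext_g (eq_of_heq hg)] }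
  obtain ⟨M, δ₁, δ₂, hM⟩ := h Φ hcrit (subgraphClosure_of_isSubgraph ⟨ι, hι, hu⟩ hG)
  -- An edge outside `S` lies outside both match images, so the dangling conditions in `G` forbid
  -- either step from deleting its endpoints.
  have hB : ∀ e, e ∉ Set.range ι.E → ∀ x, G.1.s e = ι.V x ∨ G.1.t e = ι.V x → x ∈ Φ.persist := by
    intro e he x hx
    constructor
    · rintro ⟨y, hy, rfl⟩
      have := d₁.μ.dangling e (by rw [← hg₁]; rintro ⟨f, rfl⟩; exact he ⟨_, rfl⟩) y hy
      rw [← hg₁] at this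
      exact hx.elim this.1 this.2
    · rintro ⟨y, hy, rfl⟩
      have := d₂.μ.dangling e (by rw [← hg₂]; rintro ⟨f, rfl⟩; exact he ⟨_, rfl⟩) y hy
      rw [← hg₂] at this
      exact hx.elim this.1 this.2
  obtain ⟨C, φ, hφV, hφE⟩ := exists_context ι hι Φ.persist hB
  -- The common track attaches the context to `M`; by strong joinability the second side gives the
  -- same map.
  let f' : Φ.persist → M.1.V := fun b => ((δ₁.track.comp Φ.d₁.track) b.1).get (hM b.1 b.2).2
  have hf₁ : ∀ b : Φ.persist, f' b ∈ (δ₁.track.comp Φ.d₁.track) b.1 := fun b => Part.get_mem _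
  exact ⟨C.attach M f',
    nonempty_derivation_of_factor ι φ hφV hφE Φ.d₁ δ₁ d₁ hg₁ hf₁,
    nonempty_derivation_of_factor ι φ hφV hφE Φ.d₂ δ₂ d₂ hg₂ fun b => (hM b.1 b.2).1 ▸ hf₁ b⟩

end RGT

theorem mainTheorem5 (𝓛 : RGT.LabelAlphabet.{u, v}) (T : RGT.GTSystem.{u, v, w} 𝓛)
    (D : Set (RGT.AbstractTLRG.{u, v, w} 𝓛))
    (h : ∀ Φ : RGT.DerivationPair T, Φ.IsCritical → Φ.NonGarbage D → Φ.StronglyJoinable) :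
    T.LocallyConfluentOn D :=
  RGT.locallyConfluentOn_of_stronglyJoinable h
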